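/- Let $\ell$ be a prime and let $\mu$ be the Haar measure on the compact group $\mathrm{GL}_2(\mathbb{Z}_\ell)$ with $\mu(\mathrm{GL}_2(\mathbb{Z}_\ell))=1$. With the convention $\ell^{-\mathrm{ord}_\ell(0)}=0$, the function $M\mapsto \ell^{-\mathrm{ord}_\ell(\det(M-I))}$ is $\mu$-integrable and $$\int_{\mathrm{GL}_2(\mathbb{Z}_\ell)} \ell^{-\mathrm{ord}_\ell(\det(M-I))}\,d\mu(M)=\frac{\ell^5-\ell^4-\ell^3+\ell+1}{\ell^5-\ell^3-\ell^2+1}.$$ Let $K$ be a field with separable closure $K^{\mathrm{sep}}$, let $E$ be an elliptic curve over $K$ and let $\alpha\in E(K)$. For $n\ge 0$ put $U_n=\{P\in E(K^{\mathrm{sep}}): \ell^nP=\alpha\}$, let $K_n=K(U_n)$ be the field generated over $K$ by the coordinates of the points of $U_n$, let $G_n=\mathrm{Gal}(K_n/K)$, and set $$\mathcal{F}(G_\ell(\alpha))=\lim_{n\to\infty}\frac{\#\{g\in G_n: g\text{ fixes at least one point of }U_n\}}{\#G_n}.$$ Let $T_\ell(E)=\varprojlim E[\ell^n]$, where $E[\ell^n]=\{P\in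 E(K^{\mathrm{sep}}):\ell^nP=0\}$. We say that $G_\ell(\alpha)$ is all of $\mathbb{Z}_\ell^2\rtimes\mathrm{GL}_2(\mathbb{Z}_\ell)$ if, for some sequence $\beta_0=\alpha,\beta_1,\beta_2,\dots$ in $E(K^{\mathrm{sep}})$ with $\ell\beta_{n+1}=\beta_n$ for all $n\ge 0$ and some isomorphism $T_\ell(E)\cong\mathbb{Z}_\ell^2$, the homomorphism $$\mathrm{Gal}(K^{\mathrm{sep}}/K)\to T_\ell(E)\rtimes\mathrm{Aut}(T_\ell(E))\cong\mathbb{Z}_\ell^2\rtimes\mathrm{GL}_2(\mathbb{Z}_\ell),\qquad \sigma\mapsto\big((\sigma(\beta_n)-\beta_n)_n,\ \sigma|_{T_\ell(E)}\big)$$ is surjective. Suppose that $G_\ell(\alpha)$ is all of $\mathbb{Z}_\ell^2\rtimes\mathrm{GL}_2(\mathbb{Z}_\ell)$. Then the limit $\mathcal{F}(G_\ell(\alpha))$ exists and $$\mathcal{F}(G_\ell(\alpha))=\int_{\mathrm{GL}_2(\mathbb{Z}_\ell)} \ell^{-\mathrm{ord}_\ell(\det(M-I))}\,d\mu(M)=\frac{\ell^5-\ell^4-\ell^3+\ell+1}{\ell^5-\ell^3-\ell^2+1}.$$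 In particular, if $\ell=2$, then $\mathcal{F}(G_\ell(\alpha))=\frac{11}{21}$. -/

import Mathlib

open MeasureTheory Filter Topology
open scoped WeierstrassCurve.Affine

noncomputable section

namespace EllipticArboreal

open WeierstrassCurve.Affine

universe u v

section Tree

open scoped Classical

variable {K : Type u} [Field K] (Ω : Type v) [Field Ω] [Algebra K Ω]
  (E : WeierstrassCurve K) (ℓ : ℕ)

/-- The level `U_n` of the tree of preimages of the `K`-rational point `α` under multiplication by
`ℓ`: the points `P` of `E(Ω)` with `ℓ ^ n • P = α`. Here `Ω` is a separable closure of `K`. -/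
def preimages (α : (E⁄K).Point) (n : ℕ) : Set (E⁄Ω).Point :=
  {P | ℓ ^ n • P = Point.baseChange K Ω α}

/-- The field `K_n = K(U_n)` generated over `K` by the coordinates of the points in `U_n`. -/
def levelField (α : (E⁄K).Point) (n : ℕ) : IntermediateField K Ω :=
  IntermediateField.adjoin K
    {c | ∃ x y h, Point.some x y h ∈ preimages Ω E ℓ α n ∧ (c = x ∨ c = y)}

/-- The finite-level Galois group `G_n = Gal(K_n / K)`. -/
abbrev LevelGroup (α : (E⁄K).Point) (n : ℕ) : Type v :=
  Gal(levelField Ω E ℓ α n/K)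

/-- `g ∈ G_n` fixes at least one point of `U_n`. Points of `U_n` are defined over `K_n`, so they are
the images in `E(Ω)` of points `Q` of `E(K_n)`, on which `G_n` acts coordinatewise. -/
def FixesPoint (α : (E⁄K).Point) (n : ℕ) (g : LevelGroup Ω E ℓ α n) : Prop :=
  ∃ Q : (E⁄(levelField Ω E ℓ α n)).Point,
    Point.map (levelField Ω E ℓ α n).val Q ∈ preimages Ω E ℓ α n ∧
      Point.map g.toAlgHom Q = Q

/-- The proportion of elements of `G_n` that fix at least one point of `U_n`. -/
def fixedProportion (α : (E⁄K).Point) (n : ℕ) : ℝ :=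
  (Nat.card {g : LevelGroup Ω E ℓ α n // FixesPoint Ω E ℓ α n g} : ℝ) /
    (Nat.card (LevelGroup Ω E ℓ α n) : ℝ)

/-- `IsFixedDensity Ω E ℓ α c` says that `𝓕(G_ℓ(α))`, the limit of the above proportions, exists
and is equal to `c`. -/
def IsFixedDensity (α : (E⁄K).Point) (c : ℝ) : Prop :=
  Tendsto (fixedProportion Ω E ℓ α) atTop (𝓝 c)

/-- The Tate module `T_ℓ(E) = lim E[ℓ ^ n]`, as the group of sequences `(t_n)` in `E(Ω)` with
`t_0 = 0` and `ℓ t_{n+1} = t_n` (so that `t_n` is in `E[ℓ ^ n]`). -/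
def tateModule : AddSubgroup (ℕ → (E⁄Ω).Point) where
  carrier := {t | t 0 = 0 ∧ ∀ n, ℓ • t (n + 1) = t n}
  zero_mem' := ⟨rfl, fun _ => smul_zero _⟩
  add_mem' := by
    rintro s t ⟨hs, hs'⟩ ⟨ht, ht'⟩
    refine ⟨by simp [hs, ht], fun n => ?_⟩
    simp only [Pi.add_apply, smul_add, hs', ht']
  neg_mem' := by
    rintro t ⟨ht, ht'⟩
    refine ⟨by simp [ht], fun n => ?_⟩
    simp only [Pi.neg_apply, smul_neg, ht']

/-- The coordinatewise action of an element of the Galois group on the Tate module. -/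
def galoisTate (σ : Gal(Ω/K)) : tateModule Ω E ℓ →+ tateModule Ω E ℓ where
  toFun t := ⟨fun n => Point.map σ.toAlgHom (t.1 n), by
    refine ⟨by dsimp only; rw [t.2.1, _root_.map_zero], fun n => ?_⟩
    rw [← map_nsmul, t.2.2 n]⟩
  map_zero' := by
    ext n
    exact _root_.map_zero _
  map_add' s t := by
    ext n
    exact map_add _ _ _

/-- A compatible choice of preimages of `α`: `β_0 = α` and `ℓ β_{n+1} = β_n`, so that `β_n ∈ U_n`. -/
structure PreimageChain (α : (E⁄K).Point) where
  /-- The sequence of points of `E(Ω)`. -/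
  pt : ℕ → (E⁄Ω).Point
  pt_zero : pt 0 = Point.baseChange K Ω α
  smul_pt_succ : ∀ n, ℓ • pt (n + 1) = pt n

variable {Ω E ℓ}

/-- The element `(σ(β_n) - β_n)_n` of the Tate module. -/
def kummer {α : (E⁄K).Point} (β : PreimageChain Ω E ℓ α) (σ : Gal(Ω/K)) : tateModule Ω E ℓ :=
  ⟨fun n => Point.map σ.toAlgHom (β.pt n) - β.pt n, by
    refine ⟨?_, fun n => ?_⟩
    · dsimp only
      rw [β.pt_zero, sub_eq_zero]
      exact Point.map_baseChange σ.toAlgHom α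
    · rw [smul_sub, ← map_nsmul, β.smul_pt_succ n]⟩

variable (Ω E ℓ)

/-- `G_ℓ(α)` is all of `ℤ_ℓ² ⋊ GL₂(ℤ_ℓ)`: for some compatible choice of preimages `β` and some
identification `e` of the Tate module with `ℤ_ℓ²`, the homomorphism
`σ ↦ ((σ(β_n) - β_n)_n, σ|T_ℓ(E))` from the Galois group to
`T_ℓ(E) ⋊ Aut(T_ℓ(E)) = ℤ_ℓ² ⋊ GL₂(ℤ_ℓ)` is surjective. (An additive isomorphism of `T_ℓ(E)` with
`ℤ_ℓ²` is automatically `ℤ_ℓ`-linear and a homeomorphism, since `ℓ ^ n T_ℓ(E)` is the kernel of the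
projection to `E[ℓ ^ n]`.) -/
def HasFullImage [Fact ℓ.Prime] (α : (E⁄K).Point) : Prop :=
  ∃ (β : PreimageChain Ω E ℓ α) (e : tateModule Ω E ℓ ≃+ (Fin 2 → ℤ_[ℓ])),
    ∀ (v : Fin 2 → ℤ_[ℓ]) (M : GL (Fin 2) ℤ_[ℓ]), ∃ σ : Gal(Ω/K),
      e (kummer β σ) = v ∧
        ∀ t : tateModule Ω E ℓ, e (galoisTate Ω E ℓ σ t) = M.val.mulVec (e t)

end Tree

section Integrand

variable {ℓ : ℕ} [Fact ℓ.Prime]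

open scoped Classical in
/-- `ℓ ^ (-ord_ℓ x)` for an `ℓ`-adic integer `x`, with `ord_ℓ 0 = ∞` and `ℓ ^ (-∞) = 0`. -/
def powNegOrd (x : ℤ_[ℓ]) : ℝ :=
  if x = 0 then 0 else (ℓ : ℝ) ^ (-(x.valuation : ℤ))

/-- The integrand `M ↦ ℓ ^ (-ord_ℓ (det (M - I)))` on `GL₂(ℤ_ℓ)`. -/
def integrand (M : GL (Fin 2) ℤ_[ℓ]) : ℝ :=
  powNegOrd (M.val - 1).det

end Integrand

end EllipticArboreal

end

namespace WeierstrassCurve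

variable {F : Type*} [Field F] (W : WeierstrassCurve F)

/-- The polynomial in `z`, `p`, `q` which is symmetric in its arguments and which, up to the factor
`(p - q) ^ 2`, has the `x`-coordinates of `P + Q` and `P - Q` as its roots in `z` if `p` and `q` are
the `x`-coordinates of `P` and `Q`. -/
def addSubForm (z p q : F) : F :=
  z ^ 2 * (p - q) ^ 2 - z * (2 * p * q * (p + q) + W.b₄ * (p + q) + W.b₂ * p * q + W.b₆) +
    p ^ 2 * q ^ 2 - W.b₄ * p * q - W.b₆ * (p + q) - W.b₈

lemma addSubForm_comm (z p q : F) : W.addSubForm z p q = W.addSubForm p z q := by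
  simp only [addSubForm]
  ring

lemma addSubForm_comm' (z p q : F) : W.addSubForm z p q = W.addSubForm z q p := by
  simp only [addSubForm]
  ring

namespace Affine

variable {W : Affine F}

/-- The `x`-coordinate of a point, with value `0` at infinity. -/
def Point.xCoord : W.Point → F
  | .zero => 0
  | .some x _ _ => x

lemma Point.exists_eq_some {P : W.Point} (hP : P ≠ 0) :
    ∃ y h, P = Point.some P.xCoord y h := by
  cases P with
  | zero => exact absurd rfl hP
  | some x y h => exact ⟨y, h, rfl⟩

lemma Point.xCoord_eq_iff {P Q : W.Point} (hP : P ≠ 0) (hQ : Q ≠ 0) :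
    P.xCoord = Q.xCoord ↔ P = Q ∨ P = -Q := by
  obtain ⟨y, h, hP'⟩ := exists_eq_some hP
  obtain ⟨y', h', hQ'⟩ := exists_eq_some hQ
  rw [hP', hQ']
  exact X_eq_iff

variable [DecidableEq F]

lemma Point.addSubForm_xCoord {P Q : W.Point} (hP : P ≠ 0) (hQ : Q ≠ 0)
    (hne : P.xCoord ≠ Q.xCoord) (z : F) :
    addSubForm W z P.xCoord Q.xCoord =
      (P.xCoord - Q.xCoord) ^ 2 * (z - (P + Q).xCoord) * (z - (P - Q).xCoord) := by
  obtain ⟨y, h, hP'⟩ := exists_eq_some hP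
  obtain ⟨y', h', hQ'⟩ := exists_eq_some hQ
  generalize P.xCoord = p at *
  generalize Q.xCoord = q at *
  subst hP' hQ'
  have e := (W.equation_iff _ _).1 h.1
  have e' := (W.equation_iff _ _).1 h'.1
  rw [sub_eq_add_neg (Point.some p y h), neg_some, add_of_X_ne hne, add_of_X_ne hne]
  simp only [xCoord, slope_of_X_ne hne, addX, negY, addSubForm, b₂, b₄, b₆, b₈]
  have := sub_ne_zero.2 hne
  field_simp
  grind

lemma Point.xCoord_two_nsmul {x y : F} (h : W.Nonsingular x y)
    (hy : 2 * y + W.a₁ * x + W.a₃ ≠ 0) :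
    (2 * y + W.a₁ * x + W.a₃) ^ 2 * (2 • Point.some x y h).xCoord =
      x ^ 4 - W.b₄ * x ^ 2 - 2 * W.b₆ * x - W.b₈ := by
  have e := (W.equation_iff _ _).1 h.1
  have hy' : y ≠ W.negY x y := fun h' => hy (by rw [negY] at h'; linear_combination h')
  have hy'' : y - W.negY x y = 2 * y + W.a₁ * x + W.a₃ := by rw [negY]; ring
  rw [two_nsmul, add_self_of_Y_ne hy']
  simp only [xCoord, slope_of_Y_ne rfl hy', addX, hy'', b₄, b₆, b₈]
  field_simp
  grind

end Affine

section EDS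

variable {W} (b : F) (X : ℕ → F)

/-- The elliptic divisibility sequence attached to the sequence `X` of the `x`-coordinates of the
multiples of a point and to the value `b` of the second division polynomial at this point. -/
noncomputable def edsOfX : ℕ → F
  | 0 => 0
  | 1 => 1
  | 2 => b
  | k + 3 => (X 1 - X (k + 2)) * edsOfX (k + 2) ^ 2 / edsOfX (k + 1)

variable {b X} {N : ℕ}

lemma edsOfX_ne_zero (hX : ∀ d n, 0 < d → 0 < n → d + 2 * n < N → X (d + n) ≠ X n) (hb : b ≠ 0)
    (k : ℕ) (hk : 0 < k) (hkN : k < N) : edsOfX b X k ≠ 0 := by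
  induction k using Nat.strong_induction_on with
  | _ k ih =>
    match k, hk with
    | 1, _ => simp [edsOfX]
    | 2, _ => simpa [edsOfX]
    | k + 3, _ =>
      rw [edsOfX]
      exact div_ne_zero (mul_ne_zero (sub_ne_zero.2 (hX (k + 1) 1 (by lia) (by lia) (by lia)).symm)
        (pow_ne_zero _ (ih _ (by lia) (by lia) (by lia)))) (ih _ (by lia) (by lia) (by lia))

lemma edsOfX_add_two_mul (hX : ∀ d n, 0 < d → 0 < n → d + 2 * n < N → X (d + n) ≠ X n)
    (hb : b ≠ 0) (k : ℕ) (hk : 0 < k) (hkN : k + 2 ≤ N) :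
    edsOfX b X (k + 2) * edsOfX b X k = (X 1 - X (k + 1)) * edsOfX b X (k + 1) ^ 2 := by
  obtain ⟨k, rfl⟩ := Nat.exists_eq_add_of_le' hk
  rw [edsOfX, div_mul_cancel₀ _ (edsOfX_ne_zero hX hb _ (by lia) (by lia))]

/-- The addition formula for the sequence `edsOfX`. -/
lemma edsOfX_add_two_mul_mul (hX : ∀ d n, 0 < d → 0 < n → d + 2 * n < N → X (d + n) ≠ X n)
    (hb : b ≠ 0)
    (hG : ∀ d n, 0 < d → 0 < n → d + 2 * n < N → ∀ z, W.addSubForm z (X (d + n)) (X n) =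
      (X (d + n) - X n) ^ 2 * (z - X (d + 2 * n)) * (z - X d))
    (hG₁ : ∀ z, W.addSubForm z (X 1) (X 1) = b ^ 2 * (X 2 - z)) (n : ℕ) (hn : 0 < n) :
    ∀ d, 0 < d → d + 2 * n ≤ N → edsOfX b X (d + 2 * n) * edsOfX b X d =
      (X n - X (d + n)) * edsOfX b X (d + n) ^ 2 * edsOfX b X n ^ 2 := by
  induction n using Nat.strong_induction_on with
  | _ n ih =>
    match n, hn with
    | 1, _ =>
      intro d hd hdN
      simpa [edsOfX] using edsOfX_add_two_mul hX hb d hd hdN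
    | 2, _ =>
      intro d hd hdN
      have h₁ := edsOfX_add_two_mul hX hb (d + 2) (by lia) (by lia)
      have h₂ := edsOfX_add_two_mul hX hb d (by lia) (by lia)
      have h₃ := edsOfX_add_two_mul hX hb (d + 1) (by lia) (by lia)
      have h₄ := hG (d + 1) 1 (by lia) one_pos (by lia) (X 1)
      have h₀ := edsOfX_ne_zero hX hb (d + 2) (by lia) (by lia)
      rw [addSubForm_comm, hG₁] at h₄
      refine mul_right_cancel₀ (pow_ne_zero 2 h₀) ?_
      simp only [show edsOfX b X 2 = b from rfl, add_assoc, Nat.reduceAdd, Nat.reduceMul]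
        at h₁ h₂ h₃ h₄ ⊢
      generalize edsOfX b X (d + 4) = v₄ at *
      generalize edsOfX b X (d + 3) = v₃ at *
      generalize edsOfX b X (d + 2) = v₂ at *
      generalize edsOfX b X (d + 1) = v₁ at *
      generalize edsOfX b X d = v₀ at *
      linear_combination v₀ * v₂ * h₁ + (X 1 - X (d + 3)) * v₃ ^ 2 * h₂ +
        (X 1 - X (d + 3)) * (X 1 - X (d + 1)) * (v₃ * v₁ + (X 1 - X (d + 2)) * v₂ ^ 2) * h₃ -
        v₂ ^ 4 * h₄
    | j + 3, _ =>
      intro d hd hdN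
      have h₁ := edsOfX_add_two_mul hX hb (d + 2 * j + 4) (by lia) (by lia)
      have h₂ := edsOfX_add_two_mul hX hb d (by lia) (by lia)
      have h₃ := ih (j + 2) (by lia) (by lia) (d + 1) (by lia) (by lia)
      have h₄ := ih (j + 1) (by lia) (by lia) (d + 2) (by lia) (by lia)
      have h₅ := edsOfX_add_two_mul hX hb (j + 1) (by lia) (by lia)
      have h₆ := hG (d + 1) (j + 2) (by lia) (by lia) (by lia) (X 1)
      have h₇ := hG (j + 1) 1 (by lia) (by lia) (by lia) (X (d + j + 3))
      have n₁ := edsOfX_ne_zero hX hb (d + j + 3) (by lia) (by lia)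
      have n₂ := edsOfX_ne_zero hX hb (j + 1) (by lia) (by lia)
      have n₃ := hX (d + 2) (j + 1) (by lia) (by lia) (by lia)
      rw [addSubForm_comm, addSubForm_comm'] at h₆
      simp only [show d + 2 * (j + 3) = d + 2 * j + 6 by lia, show d + (j + 3) = d + j + 3 by lia,
        show d + 1 + (j + 2) = d + j + 3 by lia, show d + 2 + (j + 1) = d + j + 3 by lia,
        show d + 1 + 2 * (j + 2) = d + 2 * j + 5 by lia,
        show d + 2 + 2 * (j + 1) = d + 2 * j + 4 by lia, add_assoc j, add_assoc (d + 2 * j),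
        Nat.reduceAdd, Nat.reduceMul] at h₁ h₂ h₃ h₄ h₅ h₆ h₇ n₁ n₂ n₃ ⊢
      refine mul_right_cancel₀ (mul_ne_zero (mul_ne_zero (sub_ne_zero.2 n₃.symm)
        (pow_ne_zero 2 n₁)) (pow_ne_zero 2 n₂)) ?_
      generalize edsOfX b X (d + 2 * j + 6) = s₆ at *
      generalize edsOfX b X (d + 2 * j + 5) = s₅ at *
      generalize edsOfX b X (d + 2 * j + 4) = s₄ at *
      generalize edsOfX b X (d + j + 3) = m₃ at *
      generalize edsOfX b X (d + 2) = v₂ at *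
      generalize edsOfX b X (d + 1) = v₁ at *
      generalize edsOfX b X d = v₀ at *
      generalize edsOfX b X (j + 1) = j₁ at *
      generalize edsOfX b X (j + 2) = j₂ at *
      generalize edsOfX b X (j + 3) = j₃ at *
      rw [h₇] at h₆
      generalize X (d + j + 3) = M at *
      linear_combination -s₆ * v₀ * h₄ + v₀ * v₂ * h₁ + (X 1 - X (d + 2 * j + 5)) * s₅ ^ 2 * h₂ +
        (X 1 - X (d + 2 * j + 5)) * (X 1 - X (d + 1)) *
          (s₅ * v₁ + (X (j + 2) - M) * m₃ ^ 2 * j₂ ^ 2) * h₃ - m₃ ^ 4 * j₂ ^ 4 * h₆ -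
        (M - X (j + 3)) * (M - X (j + 1)) * m₃ ^ 4 * (j₃ * j₁ + (X 1 - X (j + 2)) * j₂ ^ 2) * h₅

lemma edsOfX_eq_normEDS (hX : ∀ d n, 0 < d → 0 < n → d + 2 * n < N → X (d + n) ≠ X n)
    (hb : b ≠ 0)
    (hG : ∀ d n, 0 < d → 0 < n → d + 2 * n < N → ∀ z, W.addSubForm z (X (d + n)) (X n) =
      (X (d + n) - X n) ^ 2 * (z - X (d + 2 * n)) * (z - X d))
    (hG₁ : ∀ z, W.addSubForm z (X 1) (X 1) = b ^ 2 * (X 2 - z)) {c e : F}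
    (hc : 3 ≤ N → edsOfX b X 3 = c) (he : 4 ≤ N → edsOfX b X 4 = e * b) (k : ℕ) :
    k ≤ N → edsOfX b X k = normEDS b c e k := by
  induction k using normEDSRec' with
  | zero => simp [edsOfX]
  | one => simp [edsOfX]
  | two => simp [edsOfX]
  | three => simpa using hc
  | four => simpa using he
  | even m ih =>
    intro hm
    have h := edsOfX_add_two_mul_mul hX hb hG hG₁ (m + 2) (by lia) 2 (by lia) (by lia)
    have h₁ := edsOfX_add_two_mul hX hb (m + 3) (by lia) (by lia)
    have h₂ := edsOfX_add_two_mul hX hb (m + 1) (by lia) (by lia)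
    have r := normEDS_even b c e (m + 3)
    rw [show (m : ℤ) + 3 - 1 = (m + 2 : ℕ) by push_cast; ring,
      show (m : ℤ) + 3 - 2 = (m + 1 : ℕ) by push_cast; ring,
      show (m : ℤ) + 3 + 2 = (m + 5 : ℕ) by push_cast; ring,
      show (m : ℤ) + 3 + 1 = (m + 4 : ℕ) by push_cast; ring,
      show 2 * ((m : ℤ) + 3) = (2 * (m + 3) : ℕ) by push_cast; ring,
      show (m : ℤ) + 3 = (m + 3 : ℕ) by push_cast; ring,
      ← ih (m + 1) (by lia) (by lia), ← ih (m + 2) (by lia) (by lia),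
      ← ih (m + 3) (by lia) (by lia), ← ih (m + 4) (by lia) (by lia),
      ← ih (m + 5) (by lia) (by lia)] at r
    refine mul_right_cancel₀ hb ?_
    rw [r]
    simp only [show 2 + 2 * (m + 2) = 2 * (m + 3) by lia, show 2 + (m + 2) = m + 4 by lia,
      show edsOfX b X 2 = b from rfl, add_assoc, Nat.reduceAdd] at h h₁ h₂
    linear_combination h - edsOfX b X (m + 2) ^ 2 * h₁ + edsOfX b X (m + 4) ^ 2 * h₂
  | odd m ih =>
    intro hm
    have h := edsOfX_add_two_mul_mul hX hb hG hG₁ (m + 2) (by lia) 1 (by lia) (by lia)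
    have h₁ := edsOfX_add_two_mul hX hb (m + 2) (by lia) (by lia)
    have h₂ := edsOfX_add_two_mul hX hb (m + 1) (by lia) (by lia)
    have r := normEDS_odd b c e (m + 2)
    rw [show 2 * ((m : ℤ) + 2) + 1 = (2 * (m + 2) + 1 : ℕ) by push_cast; ring,
      show (m : ℤ) + 2 - 1 = (m + 1 : ℕ) by push_cast; ring,
      show (m : ℤ) + 2 + 2 = (m + 4 : ℕ) by push_cast; ring,
      show (m : ℤ) + 2 + 1 = (m + 3 : ℕ) by push_cast; ring,
      show (m : ℤ) + 2 = (m + 2 : ℕ) by push_cast; ring,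
      ← ih (m + 1) (by lia) (by lia), ← ih (m + 2) (by lia) (by lia),
      ← ih (m + 3) (by lia) (by lia), ← ih (m + 4) (by lia) (by lia)] at r
    rw [r]
    simp only [show 1 + 2 * (m + 2) = 2 * (m + 2) + 1 by lia, show 1 + (m + 2) = m + 3 by lia,
      show edsOfX b X 1 = 1 from rfl, add_assoc, Nat.reduceAdd, mul_one] at h h₁ h₂ ⊢
    linear_combination h - edsOfX b X (m + 2) ^ 2 * h₁ + edsOfX b X (m + 3) ^ 2 * h₂

end EDS

lemma preΨ₄_eval_mul_Ψ₂Sq_eval (x : F) :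
    2 * x * (x * (4 * x ^ 3 + W.b₂ * x ^ 2 + 2 * W.b₄ * x + W.b₆) -
        (x ^ 4 - W.b₄ * x ^ 2 - 2 * W.b₆ * x - W.b₈)) ^ 2 -
      (2 * (x ^ 4 - W.b₄ * x ^ 2 - 2 * W.b₆ * x - W.b₈) * x *
          ((x ^ 4 - W.b₄ * x ^ 2 - 2 * W.b₆ * x - W.b₈) +
            x * (4 * x ^ 3 + W.b₂ * x ^ 2 + 2 * W.b₄ * x + W.b₆)) +
        W.b₄ * (4 * x ^ 3 + W.b₂ * x ^ 2 + 2 * W.b₄ * x + W.b₆) *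
          ((x ^ 4 - W.b₄ * x ^ 2 - 2 * W.b₆ * x - W.b₈) +
            x * (4 * x ^ 3 + W.b₂ * x ^ 2 + 2 * W.b₄ * x + W.b₆)) +
        W.b₂ * (x ^ 4 - W.b₄ * x ^ 2 - 2 * W.b₆ * x - W.b₈) * x *
          (4 * x ^ 3 + W.b₂ * x ^ 2 + 2 * W.b₄ * x + W.b₆) +
        W.b₆ * (4 * x ^ 3 + W.b₂ * x ^ 2 + 2 * W.b₄ * x + W.b₆) ^ 2) =
      W.preΨ₄.eval x * (4 * x ^ 3 + W.b₂ * x ^ 2 + 2 * W.b₄ * x + W.b₆) := by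
  have : W.preΨ₄.eval x = 2 * x ^ 6 + W.b₂ * x ^ 5 + 5 * W.b₄ * x ^ 4 + 10 * W.b₆ * x ^ 3 +
      10 * W.b₈ * x ^ 2 + (W.b₂ * W.b₈ - W.b₄ * W.b₆) * x + (W.b₄ * W.b₈ - W.b₆ ^ 2) := by
    simp [preΨ₄]
  rw [this]
  have := W.b_relation
  grind

section EDS

variable {W} {b : F} {X : ℕ → F}
  (hB : b ^ 2 = 4 * X 1 ^ 3 + W.b₂ * X 1 ^ 2 + 2 * W.b₄ * X 1 + W.b₆)
  (h2 : b ^ 2 * X 2 = X 1 ^ 4 - W.b₄ * X 1 ^ 2 - 2 * W.b₆ * X 1 - W.b₈)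

include hB h2

lemma edsOfX_three : edsOfX b X 3 = W.Ψ₃.eval (X 1) := by
  have h : W.Ψ₃.eval (X 1) = 3 * X 1 ^ 4 + W.b₂ * X 1 ^ 3 + 3 * W.b₄ * X 1 ^ 2 + 3 * W.b₆ * X 1 +
      W.b₈ := by
    simp [Ψ₃]
  have h' : edsOfX b X 3 = (X 1 - X 2) * b ^ 2 := by simp [edsOfX]
  rw [h, h']
  linear_combination X 1 * hB - h2

lemma edsOfX_four (hb : b ≠ 0)
    (hG : ∀ z, W.addSubForm z (X 2) (X 1) = (X 2 - X 1) ^ 2 * (z - X 3) * (z - X 1)) :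
    edsOfX b X 4 = W.preΨ₄.eval (X 1) * b := by
  have h₀ := hG 0
  have h₁ := hG 1
  have hS : (X 1 - X 2) ^ 2 * (X 1 - X 3) = 2 * X 1 * (X 1 - X 2) ^ 2 -
      (2 * X 2 * X 1 * (X 2 + X 1) + W.b₄ * (X 2 + X 1) + W.b₂ * X 2 * X 1 + W.b₆) := by
    simp only [addSubForm] at h₀ h₁
    linear_combination h₀ - h₁
  have key := preΨ₄_eval_mul_Ψ₂Sq_eval W (X 1)
  rw [← hB, ← h2] at key
  have h' : edsOfX b X 4 * b = (X 1 - X 3) * ((X 1 - X 2) * b ^ 2) ^ 2 := by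
    simp [edsOfX, div_mul_cancel₀ _ hb]
  refine mul_right_cancel₀ hb ?_
  rw [h']
  linear_combination b ^ 4 * hS + key

end EDS

namespace Affine

variable {W : Affine F} [DecidableEq F]

open Polynomial

lemma Point.xCoord_add_nsmul_ne {P : W.Point} {N : ℕ} (hN : ∀ k, 0 < k → k < N → k • P ≠ 0)
    (d n : ℕ) (hd : 0 < d) (hn : 0 < n) (h : d + 2 * n < N) :
    ((d + n) • P).xCoord ≠ (n • P).xCoord := by
  rw [Ne, xCoord_eq_iff (hN _ (by lia) (by lia)) (hN _ hn (by lia))]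
  rintro (h' | h')
  · exact hN d hd (by lia) (by rwa [add_nsmul, add_eq_right] at h')
  · refine hN (d + 2 * n) (by lia) h ?_
    rw [two_mul, ← add_assoc, add_nsmul _ (d + n), h', neg_add_cancel]

/-- If `P` has no multiples `k • P = 0` with `0 < k < N`, then the values at `P` of the
division polynomials up to `N` are given by the `x`-coordinates of the multiples of `P`. -/
lemma Point.edsOfX_xCoord_eq_normEDS {x y : F} (h : W.Nonsingular x y) {N : ℕ}
    (hN : ∀ k, 0 < k → k < N → k • Point.some x y h ≠ 0)
    (hb : 2 * y + W.a₁ * x + W.a₃ ≠ 0) {k : ℕ} (hk : k ≤ N) :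
    edsOfX (2 * y + W.a₁ * x + W.a₃) (fun n => (n • Point.some x y h).xCoord) k =
      normEDS (2 * y + W.a₁ * x + W.a₃) ((Ψ₃ W).eval x) ((preΨ₄ W).eval x) k := by
  have e := (W.equation_iff _ _).1 h.1
  have h2 := Point.xCoord_two_nsmul h hb
  have hX1 : (1 • Point.some x y h).xCoord = x := by rw [one_nsmul]; rfl
  have hX := xCoord_add_nsmul_ne hN
  have hG : ∀ d n, 0 < d → 0 < n → d + 2 * n < N → ∀ z,
      addSubForm W z ((d + n) • Point.some x y h).xCoord (n • Point.some x y h).xCoord =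
      (((d + n) • Point.some x y h).xCoord - (n • Point.some x y h).xCoord) ^ 2 *
        (z - ((d + 2 * n) • Point.some x y h).xCoord) * (z - (d • Point.some x y h).xCoord) := by
    intro d n hd hn hdn z
    rw [addSubForm_xCoord (hN _ (by lia) (by lia)) (hN _ hn (by lia)) (hX d n hd hn hdn),
      ← add_nsmul, add_assoc, ← two_mul, add_nsmul _ d n, add_sub_cancel_right]
  have hB : (2 * y + W.a₁ * x + W.a₃) ^ 2 =
      4 * x ^ 3 + b₂ W * x ^ 2 + 2 * b₄ W * x + b₆ W := by
    simp only [b₂, b₄, b₆]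
    linear_combination 4 * e
  generalize 2 * y + W.a₁ * x + W.a₃ = b at hb h2 hB ⊢
  generalize hXf : (fun n : ℕ => (n • Point.some x y h).xCoord) = X at *
  have hXn (n : ℕ) : (n • Point.some x y h).xCoord = X n := congrFun hXf n
  simp only [hXn] at hX hG hX1 h2
  rw [← hX1] at hB h2 ⊢
  refine edsOfX_eq_normEDS hX hb hG ?_ (fun _ => edsOfX_three hB h2)
    (fun h4 => edsOfX_four hB h2 hb (hG 1 1 one_pos one_pos h4)) k hk
  intro z
  rw [addSubForm]
  linear_combination z * hB - h2

end Affine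

end WeierstrassCurve

namespace WeierstrassCurve.Affine

open Polynomial

variable {F : Type*} [Field F] {W : Affine F}

lemma sq_two_mul_add_eq_eval_Ψ₂Sq {x y : F} (h : W.Equation x y) :
    (2 * y + W.a₁ * x + W.a₃) ^ 2 = (Ψ₂Sq W).eval x := by
  have e := (W.equation_iff _ _).1 h
  have : (Ψ₂Sq W).eval x = 4 * x ^ 3 + b₂ W * x ^ 2 + 2 * b₄ W * x + b₆ W := by
    simp [Ψ₂Sq]
  rw [this, b₂, b₄, b₆]
  linear_combination 4 * e

lemma normEDS_eq_eval_preΨ' {x y : F} (h : W.Equation x y) (k : ℕ) :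
    normEDS (2 * y + W.a₁ * x + W.a₃) ((Ψ₃ W).eval x) ((preΨ₄ W).eval x) k =
      (preΨ' W k).eval x * if Even k then 2 * y + W.a₁ * x + W.a₃ else 1 := by
  rw [normEDS_ofNat, preΨ', ← Polynomial.coe_evalRingHom, map_preNormEDS', map_pow,
    Polynomial.coe_evalRingHom, ← sq_two_mul_add_eq_eval_Ψ₂Sq h, ← pow_mul]

variable [DecidableEq F]

lemma Point.two_nsmul_eq_zero_iff {x y : F} (h : W.Nonsingular x y) :
    2 • Point.some x y h = 0 ↔ 2 * y + W.a₁ * x + W.a₃ = 0 := by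
  rw [two_nsmul, add_eq_zero_iff_eq_neg, neg_some, Point.some.injEq, negY]
  grind

lemma Point.eval_preΨ'_ne_zero {x y : F} (h : W.Nonsingular x y) {k : ℕ} (hk : 2 < k)
    (hN : ∀ j, 0 < j → j ≤ k → j • Point.some x y h ≠ 0) : (preΨ' W k).eval x ≠ 0 := by
  have hN' : ∀ j, 0 < j → j < k + 1 → j • Point.some x y h ≠ 0 := fun j hj hjk =>
    hN j hj (by lia)
  have hb := (two_nsmul_eq_zero_iff h).not.1 (hN 2 (by lia) (by lia))
  have h₁ := edsOfX_ne_zero (X := fun n => (n • Point.some x y h).xCoord)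
    (xCoord_add_nsmul_ne hN') hb k (by lia) (by lia)
  rw [edsOfX_xCoord_eq_normEDS h hN' hb (by lia), normEDS_eq_eval_preΨ' h.1] at h₁
  exact left_ne_zero_of_mul h₁

lemma Point.eval_preΨ'_eq_zero {x y : F} (h : W.Nonsingular x y) {k : ℕ} (hk : 2 < k)
    (hN : ∀ j, 0 < j → j < k → j • Point.some x y h ≠ 0) (hP : k • Point.some x y h = 0) :
    (preΨ' W k).eval x = 0 := by
  have hb := (two_nsmul_eq_zero_iff h).not.1 (hN 2 (by lia) (by lia))
  have h₀ := edsOfX_xCoord_eq_normEDS h hN hb le_rfl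
  rw [normEDS_eq_eval_preΨ' h.1] at h₀
  obtain ⟨j, rfl⟩ : ∃ j, k = j + 3 := ⟨k - 3, by lia⟩
  have hx : ((j + 2) • Point.some x y h).xCoord = (1 • Point.some x y h).xCoord := by
    rw [xCoord_eq_iff (hN _ (by lia) (by lia)) (hN _ (by lia) (by lia))]
    right
    rw [← add_eq_zero_iff_eq_neg, ← add_nsmul, hP]
  rw [edsOfX, ← hx, sub_self, zero_mul, zero_div] at h₀
  rcases mul_eq_zero.1 h₀.symm with h₀ | h₀
  · exact h₀
  · split_ifs at h₀
    · exact absurd h₀ hb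
    · exact absurd h₀ one_ne_zero

/-- If some point is not annihilated by any `j ≤ p`, then a finite set of
`p`-torsion points has at most `p ^ 2` elements. -/
theorem Point.card_torsion_le {p : ℕ} (hp : p.Prime) {Q : W.Point}
    (hQ : ∀ j, 0 < j → j ≤ p → j • Q ≠ 0) (A : Finset W.Point) (hA : ∀ P ∈ A, p • P = 0) :
    A.card ≤ p ^ 2 := by
  have hQ0 : Q ≠ 0 := by simpa using hQ 1 one_pos hp.one_lt.le
  obtain ⟨yQ, hQ', hQe⟩ := exists_eq_some hQ0
  rw [hQe] at hQ
  have hlt : ∀ P ∈ A.erase 0, ∀ j, 0 < j → j < p → j • P ≠ 0 := by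
    intro P hP j hj hjp h0
    rw [Finset.mem_erase] at hP
    refine hP.1 ?_
    have hc : Nat.gcd p j = 1 := Nat.coprime_of_lt_prime hj.ne' hjp hp
    have := addOrderOf_dvd_of_nsmul_eq_zero h0
    have := Nat.dvd_gcd (addOrderOf_dvd_of_nsmul_eq_zero (hA P hP.2)) this
    rwa [hc, Nat.dvd_one, AddMonoid.addOrderOf_eq_one_iff] at this
  have hcard : A.card ≤ (A.erase 0).card + 1 := by
    have := Finset.pred_card_le_card_erase (s := A) (a := 0)
    lia
  suffices h : (A.erase 0).card ≤ p ^ 2 - 1 by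
    have := pow_pos hp.pos 2
    lia
  rcases hp.eq_two_or_odd' with rfl | hodd
  · have hne : Ψ₂Sq W ≠ 0 := by
      intro h0
      have := sq_two_mul_add_eq_eval_Ψ₂Sq hQ'.1
      rw [h0, eval_zero, sq_eq_zero_iff] at this
      exact hQ 2 two_pos le_rfl ((two_nsmul_eq_zero_iff _).2 this)
    have himg : (A.erase 0).image xCoord ⊆ (Ψ₂Sq W).roots.toFinset := by
      intro x hx
      obtain ⟨P, hP, rfl⟩ := Finset.mem_image.1 hx
      rw [Finset.mem_erase] at hP
      obtain ⟨y, h, hPe⟩ := exists_eq_some hP.1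
      have h2 := hA P hP.2
      rw [hPe, two_nsmul_eq_zero_iff] at h2
      rw [Multiset.mem_toFinset, mem_roots hne, IsRoot, ← sq_two_mul_add_eq_eval_Ψ₂Sq h.1, h2]
      simp
    have hinj : Set.InjOn xCoord (A.erase 0 : Set W.Point) := by
      intro P hP P' hP' h
      simp only [Finset.coe_erase, Set.mem_sdiff, Finset.mem_coe, Set.mem_singleton_iff] at hP hP'
      rcases (xCoord_eq_iff hP.2 hP'.2).1 h with h | h
      · exact h
      · have h2 := hA P' hP'.1
        rw [two_nsmul, add_eq_zero_iff_eq_neg] at h2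
        rw [h, ← h2]
    rw [← Finset.card_image_of_injOn hinj]
    calc _ ≤ _ := Finset.card_le_card himg
      _ ≤ _ := Multiset.toFinset_card_le _
      _ ≤ _ := card_roots' _
      _ ≤ 3 := natDegree_Ψ₂Sq_le W
  · have h2 : 2 < p := lt_of_le_of_ne hp.two_le (by rintro rfl; exact absurd hodd (by decide))
    have hne : preΨ' W p ≠ 0 := by
      intro h0
      exact eval_preΨ'_ne_zero hQ' h2 hQ (by rw [h0, eval_zero])
    have himg : (A.erase 0).image xCoord ⊆ (preΨ' W p).roots.toFinset := by
      intro x hx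
      obtain ⟨P, hP, rfl⟩ := Finset.mem_image.1 hx
      have hlt' := hlt P hP
      rw [Finset.mem_erase] at hP
      obtain ⟨y, h, hPe⟩ := exists_eq_some hP.1
      have h3 := hA P hP.2
      rw [hPe] at hlt' h3
      rw [Multiset.mem_toFinset, mem_roots hne, IsRoot]
      exact eval_preΨ'_eq_zero h h2 hlt' h3
    have hfib := Finset.card_le_mul_card_image (s := A.erase 0) (f := xCoord) 2 (by
      intro x hx
      obtain ⟨P, hP, rfl⟩ := Finset.mem_image.1 hx
      rw [Finset.mem_erase] at hP
      refine (Finset.card_le_card (t := {P, -P}) ?_).trans Finset.card_le_two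
      intro P' hP'
      simp only [Finset.mem_filter, Finset.mem_erase] at hP'
      simpa using (xCoord_eq_iff hP'.1.1 hP.1).1 hP'.2)
    have hroots : ((A.erase 0).image xCoord).card ≤ (p ^ 2 - 1) / 2 :=
      calc _ ≤ _ := Finset.card_le_card himg
        _ ≤ _ := Multiset.toFinset_card_le _
        _ ≤ _ := card_roots' _
        _ ≤ _ := natDegree_preΨ'_le W p
        _ = _ := by rw [if_neg (by simpa using hodd)]
    lia

end WeierstrassCurve.Affine

namespace PadicInt

variable {p : ℕ} [Fact p.Prime]

lemma toZModPow_eq_zero_iff {n : ℕ} {x : ℤ_[p]} : toZModPow n x = 0 ↔ (p : ℤ_[p]) ^ n ∣ x := by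
  rw [← RingHom.mem_ker, ker_toZModPow, Ideal.mem_span_singleton]

lemma toZModPow_surjective (n : ℕ) : Function.Surjective (toZModPow n : ℤ_[p] →+* ZMod (p ^ n)) :=
  ZMod.ringHom_surjective _

/-- Reduction modulo `p ^ n` of vectors of `p`-adic integers. -/
noncomputable def redVec (ι : Type*) (n : ℕ) : (ι → ℤ_[p]) →+ (ι → ZMod (p ^ n)) :=
  (toZModPow n : ℤ_[p] →+* ZMod (p ^ n)).toAddMonoidHom.compLeft ι

variable {ι : Type*}

@[simp]
lemma redVec_apply (n : ℕ) (v : ι → ℤ_[p]) (i : ι) : redVec ι n v i = toZModPow n (v i) := rfl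

lemma redVec_surjective (n : ℕ) :
    Function.Surjective (redVec ι n : (ι → ℤ_[p]) →+ (ι → ZMod (p ^ n))) := fun w => by
  choose v hv using fun i => toZModPow_surjective (p := p) n (w i)
  exact ⟨v, funext hv⟩

lemma redVec_eq_zero_iff {n : ℕ} {v : ι → ℤ_[p]} : redVec ι n v = 0 ↔ ∃ w, v = p ^ n • w := by
  refine ⟨fun h => ?_, ?_⟩
  · choose w hw using fun i => toZModPow_eq_zero_iff.1 (congrFun h i)
    exact ⟨w, funext fun i => by simp [hw]⟩
  · rintro ⟨w, rfl⟩
    ext i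
    simp only [redVec_apply, Pi.zero_apply, toZModPow_eq_zero_iff]
    simp

lemma eq_of_forall_redVec_eq {v w : ι → ℤ_[p]} (h : ∀ n, redVec ι n v = redVec ι n w) : v = w :=
  funext fun i => ext_of_toZModPow.1 fun n => congrFun (h n) i

/-- Additive maps between spaces of vectors of `p`-adic integers are linear. -/
lemma map_smul_of_addMonoidHom {κ : Type*} (f : (ι → ℤ_[p]) →+ (κ → ℤ_[p])) (c : ℤ_[p])
    (v : ι → ℤ_[p]) : f (c • v) = c • f v := by
  refine eq_of_forall_redVec_eq fun n => ?_
  obtain ⟨d, hd⟩ := Ideal.mem_span_singleton.1 (appr_spec n c)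
  have hc : c = (c.appr n : ℤ_[p]) + ((p ^ n : ℕ) : ℤ_[p]) * d := by
    rw [Nat.cast_pow]
    linear_combination hd
  rw [← sub_eq_zero, ← map_sub, redVec_eq_zero_iff]
  refine ⟨f (d • v) - d • f v, ?_⟩
  generalize c.appr n = k at *
  subst hc
  rw [add_smul, map_add, add_smul, mul_smul, mul_smul, Nat.cast_smul_eq_nsmul,
    Nat.cast_smul_eq_nsmul, map_nsmul, map_nsmul, Nat.cast_smul_eq_nsmul,
    Nat.cast_smul_eq_nsmul, smul_sub]
  abel

end PadicInt

noncomputable section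

namespace EllipticArboreal

open WeierstrassCurve.Affine PadicInt

universe u v

open scoped Classical

variable {K : Type u} [Field K] {Ω : Type v} [Field Ω] [Algebra K Ω]
  {E : WeierstrassCurve K} {ℓ : ℕ}

lemma pow_nsmul_add (t : tateModule Ω E ℓ) (k n : ℕ) : ℓ ^ k • t.1 (n + k) = t.1 n := by
  induction k with
  | zero => simp
  | succ k ih => rw [pow_succ, mul_smul, ← add_assoc, t.2.2, ih]

lemma pow_nsmul_eq_zero (t : tateModule Ω E ℓ) (n : ℕ) : ℓ ^ n • t.1 n = 0 := by
  simpa [t.2.1] using pow_nsmul_add t n 0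

lemma exists_eq_nsmul_of_apply_eq_zero {t : tateModule Ω E ℓ} {n : ℕ} (h : t.1 n = 0) :
    ∃ s : tateModule Ω E ℓ, t = ℓ ^ n • s := by
  refine ⟨⟨fun k => t.1 (k + n), by simpa using h, fun k => ?_⟩, ?_⟩
  · change ℓ • t.1 (k + 1 + n) = t.1 (k + n)
    rw [add_right_comm, t.2.2]
  · ext k
    exact (pow_nsmul_add t n k).symm

lemma galoisTate_mul (σ τ : Gal(Ω/K)) (t : tateModule Ω E ℓ) :
    galoisTate Ω E ℓ σ (galoisTate Ω E ℓ τ t) = galoisTate Ω E ℓ (σ * τ) t := by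
  ext n
  exact Point.map_map τ.toAlgHom σ.toAlgHom (t.1 n)

lemma galoisTate_one (t : tateModule Ω E ℓ) : galoisTate Ω E ℓ (1 : Gal(Ω/K)) t = t := by
  ext n
  change Point.map _ (t.1 n) = t.1 n
  cases t.1 n <;> rfl

section

variable [Fact ℓ.Prime] (e : tateModule Ω E ℓ ≃+ (Fin 2 → ℤ_[ℓ]))

/-- The homomorphism to `E(Ω)` given by the `n`-th component of the Tate module. -/
def toTorsion (n : ℕ) : (Fin 2 → ℤ_[ℓ]) →+ (E⁄Ω).Point :=
  ((Pi.evalAddMonoidHom (fun _ => (E⁄Ω).Point) n).comp (tateModule Ω E ℓ).subtype).comp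
    e.symm.toAddMonoidHom

lemma toTorsion_apply (n : ℕ) (v : Fin 2 → ℤ_[ℓ]) : toTorsion e n v = (e.symm v).1 n := rfl

lemma toTorsion_eq_zero_iff {n : ℕ} {v : Fin 2 → ℤ_[ℓ]} :
    toTorsion e n v = 0 ↔ redVec _ n v = 0 := by
  rw [redVec_eq_zero_iff]
  refine ⟨fun h => ?_, ?_⟩
  · rw [toTorsion_apply] at h
    obtain ⟨s, hs⟩ := exists_eq_nsmul_of_apply_eq_zero h
    exact ⟨e s, by rw [← map_nsmul, ← hs, e.apply_symm_apply]⟩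
  · rintro ⟨w, rfl⟩
    rw [map_nsmul]
    exact pow_nsmul_eq_zero _ n

lemma toTorsion_eq_iff {n : ℕ} {v w : Fin 2 → ℤ_[ℓ]} :
    toTorsion e n v = toTorsion e n w ↔ redVec _ n v = redVec _ n w := by
  rw [← sub_eq_zero, ← map_sub, toTorsion_eq_zero_iff, map_sub, sub_eq_zero]

lemma pow_nsmul_toTorsion (n : ℕ) (v : Fin 2 → ℤ_[ℓ]) : ℓ ^ n • toTorsion e n v = 0 :=
  pow_nsmul_eq_zero _ n

lemma exists_toTorsion_one_eq {P : (E⁄Ω).Point} (hP : ℓ • P = 0) : ∃ v, toTorsion e 1 v = P := by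
  have hp : ℓ.Prime := Fact.out
  by_contra! hne
  let f : (Fin 2 → ZMod (ℓ ^ 1)) → (E⁄Ω).Point :=
    fun w => toTorsion e 1 (Function.surjInv (redVec_surjective 1) w)
  have hf : Function.Injective f := by
    intro w w' h
    rwa [toTorsion_eq_iff, Function.surjInv_eq (redVec_surjective 1),
      Function.surjInv_eq (redVec_surjective 1)] at h
  have hQ : ∀ j, 0 < j → j ≤ ℓ → j • toTorsion e 2 ![1, 0] ≠ 0 := by
    intro j hj hjl h
    rw [← map_nsmul, toTorsion_eq_zero_iff] at h
    have h0 := congrFun h 0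
    simp only [redVec_apply, Pi.smul_apply, map_nsmul, Pi.zero_apply, Matrix.cons_val_zero] at h0
    rw [map_one, nsmul_one] at h0
    rw [ZMod.natCast_eq_zero_iff] at h0
    have := Nat.le_of_dvd hj h0
    have := hp.one_lt
    nlinarith
  let A : Finset (E⁄Ω).Point := insert P (Finset.univ.image f)
  have hA : A.card = ℓ ^ 2 + 1 := by
    rw [Finset.card_insert_of_notMem, Finset.card_image_of_injective _ hf]
    · simp [ZMod.card]
    · simp only [Finset.mem_image, Finset.mem_univ, true_and, not_exists]
      exact fun w => hne _
  have := Point.card_torsion_le hp hQ A (by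
    intro P' hP'
    rcases Finset.mem_insert.1 hP' with rfl | h
    · exact hP
    · obtain ⟨w, -, rfl⟩ := Finset.mem_image.1 h
      simpa using pow_nsmul_toTorsion e 1 _)
  lia

lemma exists_toTorsion_eq (n : ℕ) {P : (E⁄Ω).Point} (hP : ℓ ^ n • P = 0) :
    ∃ v, toTorsion e n v = P := by
  induction n generalizing P with
  | zero => exact ⟨0, by simpa using hP.symm⟩
  | succ n ih =>
    obtain ⟨v, hv⟩ := exists_toTorsion_one_eq e (P := ℓ ^ n • P)
      (by rw [← mul_smul, ← pow_succ', hP])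
    have h₁ : ℓ ^ n • toTorsion e (n + 1) v = toTorsion e 1 v := by
      rw [add_comm]
      exact pow_nsmul_add _ n 1
    obtain ⟨w, hw⟩ := ih (P := P - toTorsion e (n + 1) v) (by rw [smul_sub, h₁, hv, sub_self])
    refine ⟨v + ℓ • w, ?_⟩
    have h₂ : ℓ • toTorsion e (n + 1) w = toTorsion e n w := (e.symm w).2.2 n
    rw [map_add, map_nsmul, h₂, hw]
    abel

lemma exists_matrix_galoisTate (σ : Gal(Ω/K)) : ∃ M : Matrix (Fin 2) (Fin 2) ℤ_[ℓ],
    ∀ t : tateModule Ω E ℓ, e (galoisTate Ω E ℓ σ t) = M.mulVec (e t) := by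
  let f : (Fin 2 → ℤ_[ℓ]) →+ (Fin 2 → ℤ_[ℓ]) :=
    (e.toAddMonoidHom.comp (galoisTate Ω E ℓ σ)).comp e.symm.toAddMonoidHom
  let g : (Fin 2 → ℤ_[ℓ]) →ₗ[ℤ_[ℓ]] (Fin 2 → ℤ_[ℓ]) :=
    { f with map_smul' := map_smul_of_addMonoidHom f }
  refine ⟨LinearMap.toMatrix' g, fun t => ?_⟩
  rw [LinearMap.toMatrix'_mulVec]
  change _ = e (galoisTate Ω E ℓ σ (e.symm (e t)))
  rw [e.symm_apply_apply]

lemma exists_GL_galoisTate (σ : Gal(Ω/K)) : ∃ M : GL (Fin 2) ℤ_[ℓ],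
    ∀ t : tateModule Ω E ℓ, e (galoisTate Ω E ℓ σ t) = M.val.mulVec (e t) := by
  obtain ⟨M, hM⟩ := exists_matrix_galoisTate e σ
  obtain ⟨N, hN⟩ := exists_matrix_galoisTate e σ⁻¹
  have h (v : Fin 2 → ℤ_[ℓ]) : (M * N).mulVec v = (1 : Matrix (Fin 2) (Fin 2) ℤ_[ℓ]).mulVec v := by
    obtain ⟨t, rfl⟩ := e.surjective v
    rw [← Matrix.mulVec_mulVec, ← hN, ← hM, galoisTate_mul, mul_inv_cancel, galoisTate_one,
      Matrix.one_mulVec]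
  have h' : M * N = 1 := Matrix.mulVec_injective (funext h)
  exact ⟨⟨M, N, h', mul_eq_one_comm.1 h'⟩, hM⟩

lemma map_toTorsion {σ : Gal(Ω/K)} {M : GL (Fin 2) ℤ_[ℓ]}
    (hM : ∀ t : tateModule Ω E ℓ, e (galoisTate Ω E ℓ σ t) = M.val.mulVec (e t)) (n : ℕ)
    (v : Fin 2 → ℤ_[ℓ]) :
    Point.map σ.toAlgHom (toTorsion e n v) = toTorsion e n (M.val.mulVec v) := by
  have := hM (e.symm v)
  rw [e.apply_symm_apply] at this
  rw [← this, toTorsion_apply, toTorsion_apply, e.symm_apply_apply]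
  rfl

end

end EllipticArboreal

end

noncomputable section

/-- Two surjections with the same fibres have equivalent targets. -/
lemma exists_equiv_of_surjective_of_eq_iff_eq {S A B : Type*} {f : S → A} {g : S → B}
    (hf : Function.Surjective f) (hg : Function.Surjective g)
    (h : ∀ s t, f s = f t ↔ g s = g t) : ∃ φ : A ≃ B, ∀ s, φ (f s) = g s := by
  have hφ (s : S) : g (Function.surjInv hf (f s)) = g s :=
    (h _ _).1 (Function.surjInv_eq hf (f s))
  refine ⟨Equiv.ofBijective (fun a => g (Function.surjInv hf a)) ⟨fun a b hab => ?_, fun b => ?_⟩,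
    hφ⟩
  · have := (h _ _).2 hab
    rwa [Function.surjInv_eq hf, Function.surjInv_eq hf] at this
  · obtain ⟨s, rfl⟩ := hg b
    exact ⟨f s, hφ s⟩

namespace PadicInt

variable {p : ℕ} [Fact p.Prime]

/-- Reduction modulo `p ^ n` of invertible matrices of `p`-adic integers. -/
def redGL (ι : Type*) [Fintype ι] [DecidableEq ι] (n : ℕ) : GL ι ℤ_[p] →* GL ι (ZMod (p ^ n)) :=
  Matrix.GeneralLinearGroup.map (toZModPow n)

variable {ι : Type*} [Fintype ι]

lemma redVec_mulVec (n : ℕ) (M : Matrix ι ι ℤ_[p]) (v : ι → ℤ_[p]) :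
    redVec ι n (M.mulVec v) = (M.map (toZModPow n)).mulVec (redVec ι n v) :=
  funext fun i => RingHom.map_mulVec (toZModPow n) M v i

lemma redVec_mulVec_eq_iff [DecidableEq ι] {n : ℕ} {M N : GL ι ℤ_[p]} :
    (∀ v, redVec ι n (M.val.mulVec v) = redVec ι n (N.val.mulVec v)) ↔
      redGL ι n M = redGL ι n N := by
  refine ⟨fun h => Units.ext (Matrix.mulVec_injective (funext fun w => ?_)), fun h v => ?_⟩
  · obtain ⟨v, rfl⟩ := redVec_surjective n w
    have := h v
    rwa [redVec_mulVec, redVec_mulVec] at this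
  · rw [redVec_mulVec, redVec_mulVec]
    exact congrArg (fun A => A.val.mulVec (redVec ι n v)) h

end PadicInt

namespace EllipticArboreal

open WeierstrassCurve.Affine PadicInt

universe u v

open scoped Classical

variable {K : Type u} [Field K] {Ω : Type v} [Field Ω] [Algebra K Ω]
  {E : WeierstrassCurve K} {ℓ : ℕ} {α : (E⁄K).Point}

lemma map_mem_preimages (σ : Gal(Ω/K)) {n : ℕ} {P : (E⁄Ω).Point}
    (hP : P ∈ preimages Ω E ℓ α n) : Point.map σ.toAlgHom P ∈ preimages Ω E ℓ α n := by
  change ℓ ^ n • _ = _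
  rw [← map_nsmul, show ℓ ^ n • P = _ from hP]
  exact Point.map_baseChange σ.toAlgHom α

lemma normal_levelField [Normal K Ω] (n : ℕ) : Normal K (levelField Ω E ℓ α n) := by
  rw [IntermediateField.normal_iff_forall_map_le']
  intro σ
  rw [levelField, IntermediateField.adjoin_map, IntermediateField.adjoin_le_iff]
  rintro _ ⟨c, ⟨x, y, h, hP, hc⟩, rfl⟩
  refine IntermediateField.subset_adjoin _ _ ⟨_, _, _, map_mem_preimages σ hP, ?_⟩
  exact hc.imp (congrArg _) (congrArg _)

lemma map_restrictNormal [Normal K Ω] {L : IntermediateField K Ω} [Normal K L] (σ : Gal(Ω/K))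
    (Q : (E⁄L).Point) : Point.map L.val (Point.map (σ.restrictNormal L).toAlgHom Q) =
      Point.map σ.toAlgHom (Point.map L.val Q) := by
  rw [Point.map_map, Point.map_map]
  congr 1
  congr 1
  ext x
  exact σ.restrictNormal_commutes L x

lemma restrictNormal_levelField_eq_iff [Normal K Ω] {n : ℕ} [Normal K (levelField Ω E ℓ α n)]
    (σ τ : Gal(Ω/K)) :
    σ.restrictNormal (levelField Ω E ℓ α n) = τ.restrictNormal (levelField Ω E ℓ α n) ↔
      ∀ P ∈ preimages Ω E ℓ α n, Point.map σ.toAlgHom P = Point.map τ.toAlgHom P := by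
  have h : σ.restrictNormal (levelField Ω E ℓ α n) = τ.restrictNormal (levelField Ω E ℓ α n) ↔
      ∀ x ∈ levelField Ω E ℓ α n, σ x = τ x := by
    simp [AlgEquiv.ext_iff, Subtype.ext_iff, AlgEquiv.restrictNormal_apply]
  rw [h]
  constructor
  · intro h P hP
    cases P with
    | zero => rfl
    | some x y hxy =>
      rw [Point.map_some, Point.map_some, Point.some.injEq]
      exact ⟨h x (IntermediateField.subset_adjoin _ _ ⟨x, y, hxy, hP, .inl rfl⟩),
        h y (IntermediateField.subset_adjoin _ _ ⟨x, y, hxy, hP, .inr rfl⟩)⟩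
  · intro h x hx
    induction hx using IntermediateField.adjoin_induction with
    | mem c hc =>
      obtain ⟨x, y, hxy, hP, hc⟩ := hc
      have := h _ hP
      rw [Point.map_some, Point.map_some, Point.some.injEq] at this
      rcases hc with rfl | rfl
      exacts [this.1, this.2]
    | algebraMap x => simp
    | add x y _ _ hx hy => rw [map_add, map_add, hx, hy]
    | inv x _ hx => rw [map_inv₀, map_inv₀, hx]
    | mul x y _ _ hx hy => rw [map_mul, map_mul, hx, hy]

lemma exists_map_val_eq {n : ℕ} {P : (E⁄Ω).Point} (hP : P ∈ preimages Ω E ℓ α n) :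
    ∃ Q : (E⁄(levelField Ω E ℓ α n)).Point, Point.map (levelField Ω E ℓ α n).val Q = P := by
  cases P with
  | zero => exact ⟨0, rfl⟩
  | some x y hxy =>
    have hx : x ∈ levelField Ω E ℓ α n :=
      IntermediateField.subset_adjoin _ _ ⟨x, y, hxy, hP, .inl rfl⟩
    have hy : y ∈ levelField Ω E ℓ α n :=
      IntermediateField.subset_adjoin _ _ ⟨x, y, hxy, hP, .inr rfl⟩
    exact ⟨.some ⟨x, hx⟩ ⟨y, hy⟩ ((WeierstrassCurve.Affine.baseChange_nonsingular E
      (f := (levelField Ω E ℓ α n).val) (levelField Ω E ℓ α n).val.injective _ _).1 hxy), rfl⟩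

lemma fixesPoint_restrictNormal_iff [Normal K Ω] {n : ℕ} [Normal K (levelField Ω E ℓ α n)]
    (σ : Gal(Ω/K)) : FixesPoint Ω E ℓ α n (σ.restrictNormal (levelField Ω E ℓ α n)) ↔
      ∃ P ∈ preimages Ω E ℓ α n, Point.map σ.toAlgHom P = P := by
  constructor
  · rintro ⟨Q, hQ, h⟩
    exact ⟨_, hQ, by rw [← map_restrictNormal, h]⟩
  · rintro ⟨P, hP, h⟩
    obtain ⟨Q, rfl⟩ := exists_map_val_eq hP
    exact ⟨Q, hP, Point.map_injective _ (by rw [map_restrictNormal, h])⟩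

section

variable [Fact ℓ.Prime] (β : PreimageChain Ω E ℓ α) (e : tateModule Ω E ℓ ≃+ (Fin 2 → ℤ_[ℓ]))

omit [Fact ℓ.Prime] in
lemma PreimageChain.pt_mem (n : ℕ) : β.pt n ∈ preimages Ω E ℓ α n := by
  change ℓ ^ n • β.pt n = _
  rw [← β.pt_zero]
  induction n with
  | zero => simp
  | succ n ih => rw [pow_succ, mul_smul, β.smul_pt_succ, ih]

lemma mem_preimages_iff {n : ℕ} {P : (E⁄Ω).Point} :
    P ∈ preimages Ω E ℓ α n ↔ ∃ u, β.pt n + toTorsion e n u = P := by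
  have hβ : ℓ ^ n • β.pt n = _ := β.pt_mem n
  constructor
  · intro hP
    have hP' : ℓ ^ n • P = _ := hP
    obtain ⟨u, hu⟩ := exists_toTorsion_eq e n (P := P - β.pt n)
      (by rw [smul_sub, hP', hβ, sub_self])
    exact ⟨u, by rw [hu]; abel⟩
  · rintro ⟨u, rfl⟩
    change ℓ ^ n • _ = _
    rw [smul_add, hβ, pow_nsmul_toTorsion, add_zero]

lemma map_pt_add_toTorsion {σ : Gal(Ω/K)} {M : GL (Fin 2) ℤ_[ℓ]}
    (hM : ∀ t : tateModule Ω E ℓ, e (galoisTate Ω E ℓ σ t) = M.val.mulVec (e t)) (n : ℕ)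
    (u : Fin 2 → ℤ_[ℓ]) : Point.map σ.toAlgHom (β.pt n + toTorsion e n u) =
      β.pt n + toTorsion e n (e (kummer β σ) + M.val.mulVec u) := by
  have hk : toTorsion e n (e (kummer β σ)) = Point.map σ.toAlgHom (β.pt n) - β.pt n := by
    rw [toTorsion_apply, e.symm_apply_apply]
    rfl
  rw [map_add, map_toTorsion e hM, map_add, hk]
  abel

/-- The level group `G_n` is the semidirect product of `(ℤ/ℓⁿ)²` and of the image of `GL₂(ℤ_ℓ)`
in `GL₂(ℤ/ℓⁿ)`. -/
lemma exists_levelGroup_equiv [Normal K Ω]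
    (h : ∀ (v : Fin 2 → ℤ_[ℓ]) (M : GL (Fin 2) ℤ_[ℓ]), ∃ σ : Gal(Ω/K), e (kummer β σ) = v ∧
      ∀ t : tateModule Ω E ℓ, e (galoisTate Ω E ℓ σ t) = M.val.mulVec (e t)) (n : ℕ) :
    ∃ φ : LevelGroup Ω E ℓ α n ≃
        (Fin 2 → ZMod (ℓ ^ n)) × (redGL (p := ℓ) (Fin 2) n).range,
      ∀ g, FixesPoint Ω E ℓ α n g ↔ ∃ u, (φ g).1 + (φ g).2.1.val.mulVec u = u := by
  have := normal_levelField (Ω := Ω) (E := E) (ℓ := ℓ) (α := α) n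
  choose M hM using fun σ : Gal(Ω/K) => exists_GL_galoisTate e σ
  have hsurj : Function.Surjective fun σ : Gal(Ω/K) =>
      (redVec (Fin 2) n (e (kummer β σ)), (redGL (Fin 2) n).rangeRestrict (M σ)) := by
    rintro ⟨w, ⟨_, ⟨N, rfl⟩⟩⟩
    obtain ⟨v, rfl⟩ := redVec_surjective n w
    obtain ⟨σ, hσ, hσN⟩ := h v N
    refine ⟨σ, ?_⟩
    have : M σ = N := by
      refine Units.ext (Matrix.mulVec_injective (funext fun x => ?_))
      obtain ⟨t, rfl⟩ := e.surjective x
      rw [← hM, hσN]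
    dsimp only
    rw [hσ, this]
    rfl
  have hiff : ∀ σ τ : Gal(Ω/K), AlgEquiv.restrictNormalHom (levelField Ω E ℓ α n) σ =
      AlgEquiv.restrictNormalHom (levelField Ω E ℓ α n) τ ↔
      (redVec (Fin 2) n (e (kummer β σ)), (redGL (Fin 2) n).rangeRestrict (M σ)) =
        (redVec (Fin 2) n (e (kummer β τ)), (redGL (Fin 2) n).rangeRestrict (M τ)) := by
    intro σ τ
    refine (restrictNormal_levelField_eq_iff σ τ).trans ?_
    rw [Prod.mk.injEq, Subtype.ext_iff]
    change _ ↔ _ ∧ redGL (Fin 2) n (M σ) = redGL (Fin 2) n (M τ)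
    rw [← redVec_mulVec_eq_iff]
    have key : (∀ P ∈ preimages Ω E ℓ α n, Point.map σ.toAlgHom P = Point.map τ.toAlgHom P) ↔
        ∀ u, redVec (Fin 2) n (e (kummer β σ)) + redVec (Fin 2) n ((M σ).val.mulVec u) =
          redVec (Fin 2) n (e (kummer β τ)) + redVec (Fin 2) n ((M τ).val.mulVec u) := by
      simp only [mem_preimages_iff β e, forall_exists_index, forall_apply_eq_imp_iff,
        map_pt_add_toTorsion β e (hM σ), map_pt_add_toTorsion β e (hM τ), add_right_inj,
        ← map_add, toTorsion_eq_iff]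
    rw [key]
    constructor
    · intro h
      have h0 : redVec (Fin 2) n (e (kummer β σ)) = redVec (Fin 2) n (e (kummer β τ)) := by
        simpa using h 0
      exact ⟨h0, fun u => by simpa [h0] using h u⟩
    · rintro ⟨h0, h1⟩ u
      rw [h0, h1]
  obtain ⟨φ, hφ⟩ := exists_equiv_of_surjective_of_eq_iff_eq
    (AlgEquiv.restrictNormalHom_surjective (F := K) (K₁ := levelField Ω E ℓ α n) Ω) hsurj hiff
  refine ⟨φ, fun g => ?_⟩
  obtain ⟨σ, rfl⟩ := AlgEquiv.restrictNormalHom_surjective (F := K) (K₁ := levelField Ω E ℓ α n) Ω g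
  refine (fixesPoint_restrictNormal_iff σ).trans ?_
  have hσ : φ (AlgEquiv.restrictNormalHom (levelField Ω E ℓ α n) σ) = _ := hφ σ
  rw [hσ]
  constructor
  · rintro ⟨P, hP, hPσ⟩
    obtain ⟨u, rfl⟩ := (mem_preimages_iff β e).1 hP
    rw [map_pt_add_toTorsion β e (hM σ), add_right_inj, toTorsion_eq_iff, map_add,
      redVec_mulVec] at hPσ
    exact ⟨_, hPσ⟩
  · rintro ⟨w, hw⟩
    obtain ⟨u, rfl⟩ := redVec_surjective n w
    refine ⟨_, (mem_preimages_iff β e).2 ⟨u, rfl⟩, ?_⟩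
    rw [map_pt_add_toTorsion β e (hM σ), add_right_inj, toTorsion_eq_iff, map_add,
      redVec_mulVec]
    exact hw

end

end EllipticArboreal

end

noncomputable section

/-- The proportion of vectors in the range of a `2 × 2` matrix. -/
def Matrix.rangeDensity {R : Type*} [CommRing R] (N : Matrix (Fin 2) (Fin 2) R) : ℝ :=
  Nat.card (Set.range N.mulVec) / (Nat.card R : ℝ) ^ 2

namespace EllipticArboreal

open WeierstrassCurve.Affine PadicInt

universe u v

open scoped Classical

variable {K : Type u} [Field K] {Ω : Type v} [Field Ω] [Algebra K Ω]
  {E : WeierstrassCurve K} {ℓ : ℕ} {α : (E⁄K).Point} [Fact ℓ.Prime]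

lemma setOf_exists_add_mulVec_eq {R : Type*} [CommRing R] (M : Matrix (Fin 2) (Fin 2) R) :
    {w | ∃ u, w + M.mulVec u = u} = Set.range (M - 1).mulVec := by
  ext w
  constructor
  · rintro ⟨u, hu⟩
    refine ⟨-u, ?_⟩
    rw [Matrix.mulVec_neg, Matrix.sub_mulVec, Matrix.one_mulVec, neg_sub, sub_eq_iff_eq_add, hu]
  · rintro ⟨u, rfl⟩
    refine ⟨-u, ?_⟩
    rw [Matrix.mulVec_neg, Matrix.sub_mulVec, Matrix.one_mulVec]
    abel

lemma HasFullImage.fixedProportion_eq [Normal K Ω] (h : HasFullImage Ω E ℓ α) (n : ℕ) :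
    fixedProportion Ω E ℓ α n =
      (∑ g : (redGL (p := ℓ) (Fin 2) n).range, Matrix.rangeDensity (g.1.val - 1)) /
        Nat.card (redGL (p := ℓ) (Fin 2) n).range := by
  obtain ⟨β, e, h⟩ := h
  obtain ⟨φ, hφ⟩ := exists_levelGroup_equiv β e h n
  have h₁ : Nat.card (LevelGroup Ω E ℓ α n) =
      Nat.card (ZMod (ℓ ^ n)) ^ 2 * Nat.card (redGL (p := ℓ) (Fin 2) n).range := by
    rw [Nat.card_congr φ, Nat.card_prod, Nat.card_fun]
    simp
  have h₂ : Nat.card {g : LevelGroup Ω E ℓ α n // FixesPoint Ω E ℓ α n g} =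
      ∑ g : (redGL (p := ℓ) (Fin 2) n).range, Nat.card (Set.range (g.1.val - 1).mulVec) := by
    rw [Nat.card_congr (((φ.trans (Equiv.prodComm _ _)).subtypeEquiv
      (q := fun a => ∃ u, a.2 + a.1.1.val.mulVec u = u) hφ).trans
      (Equiv.subtypeProdEquivSigmaSubtype fun (a : (redGL (p := ℓ) (Fin 2) n).range)
        (w : Fin 2 → ZMod (ℓ ^ n)) => ∃ u, w + a.1.val.mulVec u = u)),
      Nat.card_sigma]
    refine Finset.sum_congr rfl fun g _ => ?_
    rw [← setOf_exists_add_mulVec_eq]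
    rfl
  have h₀ : (Nat.card (ZMod (ℓ ^ n)) : ℝ) ≠ 0 := by simp [NeZero.ne ℓ]
  rw [fixedProportion, h₁, h₂]
  simp only [Matrix.rangeDensity]
  rw [← Finset.sum_div]
  push_cast
  rw [div_div]

end EllipticArboreal

end

noncomputable section

/-- The integral of a function which factors through a finite quotient is an average. -/
@[to_additive]
lemma integral_comp_monoidHom_of_finite {G H : Type*} [Group G] [MeasurableSpace G]
    [MeasurableMul G] [Group H] [Fintype H] {μ : Measure G} [μ.IsMulLeftInvariant]
    [IsProbabilityMeasure μ] {φ : G →* H} (hφ : Function.Surjective φ)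
    (hm : ∀ h, MeasurableSet (φ ⁻¹' {h})) (f : H → ℝ) :
    ∫ x, f (φ x) ∂μ = (∑ h, f h) / Nat.card H := by
  let _ : MeasurableSpace H := ⊤
  have hmeas : Measurable φ := measurable_to_countable' hm
  have hprob : IsProbabilityMeasure (μ.map φ) := Measure.isProbabilityMeasure_map hmeas.aemeasurable
  have hreal : ∀ h, (μ.map φ).real {h} = (μ.map φ).real {1} := by
    intro h
    obtain ⟨g, rfl⟩ := hφ h
    rw [map_measureReal_apply hmeas trivial, map_measureReal_apply hmeas trivial, measureReal_def,
      measureReal_def, ← measure_preimage_mul μ g]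
    congr 2
    ext x
    simp
  have hsum : ∑ h : H, (μ.map φ).real {h} = 1 := by
    rw [sum_measureReal_singleton, Finset.coe_univ, probReal_univ]
  simp only [hreal, Finset.sum_const, Finset.card_univ, nsmul_eq_mul] at hsum
  rw [← integral_map (f := f) hmeas.aemeasurable (Measurable.of_discrete).aestronglyMeasurable,
    integral_fintype (Integrable.of_finite)]
  simp only [hreal, smul_eq_mul]
  rw [← Finset.mul_sum, Nat.card_eq_fintype_card, eq_div_iff (by rintro h; simp [h] at hsum)]
  linear_combination (∑ h, f h) * hsum

namespace Matrix

variable {R : Type*} [CommRing R]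

lemma rangeDensity_mul_mul (U V : GL (Fin 2) R) (N : Matrix (Fin 2) (Fin 2) R) :
    rangeDensity (U.val * N * V.val) = rangeDensity N := by
  have hU : Function.Injective U.val.mulVec := mulVec_injective_of_isUnit U.isUnit
  have hV : Function.Surjective V.val.mulVec := mulVec_surjective_iff_isUnit.2 V.isUnit
  have : Set.range (U.val * N * V.val).mulVec = U.val.mulVec '' Set.range N.mulVec := by
    rw [← Set.range_comp, ← hV.range_comp (U.val.mulVec ∘ N.mulVec)]
    congr 1
    ext1 v
    simp only [Function.comp_apply, mulVec_mulVec, mul_assoc]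
  rw [rangeDensity, rangeDensity, this, Nat.card_image_of_injective hU]

lemma rangeDensity_diagonal (a b : R) : rangeDensity (diagonal ![a, b]) =
    (Nat.card (Set.range (a * ·)) / (Nat.card R : ℝ)) *
      (Nat.card (Set.range (b * ·)) / (Nat.card R : ℝ)) := by
  let f : Set.range (diagonal ![a, b]).mulVec ≃ Set.range (a * ·) × Set.range (b * ·) :=
    { toFun v := (⟨v.1 0, by obtain ⟨w, hw⟩ := v.2; exact ⟨w 0, by simp [← hw, mulVec_diagonal]⟩⟩,
        ⟨v.1 1, by obtain ⟨w, hw⟩ := v.2; exact ⟨w 1, by simp [← hw, mulVec_diagonal]⟩⟩)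
      invFun x := ⟨![x.1.1, x.2.1], by
        obtain ⟨⟨_, s, rfl⟩, ⟨_, t, rfl⟩⟩ := x
        exact ⟨![s, t], by ext i; fin_cases i <;> simp [mulVec_diagonal]⟩⟩
      left_inv v := by
        ext i
        fin_cases i <;> rfl
      right_inv x := rfl }
  rw [rangeDensity, Nat.card_congr f, Nat.card_prod]
  push_cast
  ring

end Matrix

namespace PadicInt

variable {p : ℕ} [Fact p.Prime]

lemma dvd_of_norm_le {x y : ℤ_[p]} (h : ‖y‖ ≤ ‖x‖) : x ∣ y := by
  rcases eq_or_ne x 0 with rfl | hx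
  · rw [norm_zero, norm_le_zero_iff] at h
    rw [h]
  · rw [norm_eq_zpow_neg_valuation hx, norm_le_pow_iff_mem_span_pow, Ideal.mem_span_singleton] at h
    refine dvd_trans ?_ h
    conv_lhs => rw [unitCoeff_spec hx]
    exact (Units.mul_left_dvd (u := unitCoeff hx)).2 dvd_rfl

open Matrix

lemma exists_smith_of_dvd {N : Matrix (Fin 2) (Fin 2) ℤ_[p]} (h : ∀ i j, N 0 0 ∣ N i j) :
    ∃ (U V : GL (Fin 2) ℤ_[p]) (a b : ℤ_[p]),
      N = U.val * diagonal ![a, a * b] * V.val := by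
  obtain ⟨b, hb⟩ := h 0 1
  obtain ⟨c, hc⟩ := h 1 0
  obtain ⟨d, hd⟩ := h 1 1
  refine ⟨⟨!![1, 0; c, 1], !![1, 0; -c, 1], ?_, ?_⟩, ⟨!![1, b; 0, 1], !![1, -b; 0, 1], ?_, ?_⟩,
    N 0 0, d - c * b, ?_⟩
  · simp [Matrix.one_fin_two]
  · simp [Matrix.one_fin_two]
  · simp [Matrix.one_fin_two]
  · simp [Matrix.one_fin_two]
  · ext i j
    fin_cases i <;> fin_cases j <;> simp [Matrix.mul_apply, vecMul, dotProduct, diagonal_apply, hb, hc, hd] <;> ring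

/-- The exchange of the two coordinates. -/
def swapGL : GL (Fin 2) ℤ_[p] :=
  ⟨!![0, 1; 1, 0], !![0, 1; 1, 0], by simp [Matrix.one_fin_two], by simp [Matrix.one_fin_two]⟩

/-- The Smith normal form of `2 × 2` matrices of `p`-adic integers. -/
lemma exists_smith (N : Matrix (Fin 2) (Fin 2) ℤ_[p]) :
    ∃ (U V : GL (Fin 2) ℤ_[p]) (a b : ℤ_[p]),
      N = U.val * diagonal ![a, a * b] * V.val := by
  obtain ⟨⟨i, j⟩, hij⟩ := Finite.exists_max fun x : Fin 2 × Fin 2 => ‖N x.1 x.2‖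
  obtain ⟨A, B, h00⟩ : ∃ A B : GL (Fin 2) ℤ_[p],
      (A.val * N * B.val) 0 0 = N i j ∧ ∀ k l, ∃ k' l', (A.val * N * B.val) k l = N k' l' := by
    have hs : swapGL.val = (!![0, 1; 1, 0] : Matrix (Fin 2) (Fin 2) ℤ_[p]) := rfl
    refine ⟨if i = 0 then 1 else swapGL, if j = 0 then 1 else swapGL, ?_, fun k l =>
      ⟨if i = 0 then k else 1 - k, if j = 0 then l else 1 - l, ?_⟩⟩
    · fin_cases i <;> fin_cases j <;> simp [hs, Matrix.mul_apply, vecMul, dotProduct]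
    · fin_cases i <;> fin_cases j <;> fin_cases k <;> fin_cases l <;>
        simp [hs, Matrix.mul_apply, vecMul, dotProduct]
  obtain ⟨U, V, a, b, h⟩ := exists_smith_of_dvd (N := A.val * N * B.val) (by
    intro k l
    obtain ⟨k', l', h⟩ := h00.2 k l
    rw [h00.1, h]
    exact dvd_of_norm_le (hij (k', l')))
  refine ⟨A⁻¹ * U, V * B⁻¹, a, b, ?_⟩
  calc N = A⁻¹.val * (A.val * N * B.val) * B⁻¹.val := by
        simp only [mul_assoc, Units.mul_inv, mul_one, Units.inv_mul_cancel_left]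
    _ = _ := by
        rw [h]
        simp only [mul_assoc, Units.val_mul]

lemma norm_det_GL (U : GL (Fin 2) ℤ_[p]) : ‖U.val.det‖ = 1 :=
  isUnit_iff.1 ((Matrix.isUnit_iff_isUnit_det _).1 U.isUnit)

lemma tendsto_card_range_mul (a : ℤ_[p]) : Tendsto (fun n : ℕ =>
    (Nat.card (Set.range (toZModPow n a * ·)) : ℝ) / Nat.card (ZMod (p ^ n))) atTop (𝓝 ‖a‖) := by
  have hp : (p : ℝ) ≠ 0 := by simp [NeZero.ne p]
  have hp1 : 1 < (p : ℝ) := by exact_mod_cast (Fact.out : p.Prime).one_lt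
  rcases eq_or_ne a 0 with rfl | ha
  · have h : Tendsto (fun n : ℕ => ((p : ℝ)⁻¹) ^ n) atTop (𝓝 0) :=
      tendsto_pow_atTop_nhds_zero_of_lt_one (by positivity) (inv_lt_one_of_one_lt₀ hp1)
    rw [norm_zero]
    refine h.congr fun n => ?_
    simp
  · refine tendsto_const_nhds.congr' ?_
    filter_upwards [eventually_ge_atTop a.valuation] with n hn
    have hu : IsUnit (toZModPow n (unitCoeff ha : ℤ_[p])) := (unitCoeff ha).isUnit.map _
    obtain ⟨u, hu⟩ := hu
    have h₁ : Set.range (toZModPow n a * ·) =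
        AddSubgroup.zmultiples ((p ^ a.valuation : ℕ) : ZMod (p ^ n)) := by
      have h₂ : toZModPow n a = u * ((p ^ a.valuation : ℕ) : ZMod (p ^ n)) := by
        conv_lhs => rw [unitCoeff_spec ha]
        rw [hu]
        simp
      ext x
      simp only [Set.mem_range, SetLike.mem_coe, AddSubgroup.mem_zmultiples_iff, h₂]
      constructor
      · rintro ⟨y, rfl⟩
        obtain ⟨k, hk⟩ := ZMod.intCast_surjective (u.val * y)
        exact ⟨k, by rw [zsmul_eq_mul, hk]; ring⟩
      · rintro ⟨k, rfl⟩
        refine ⟨u⁻¹.val * k, ?_⟩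
        rw [zsmul_eq_mul]
        linear_combination ((p ^ a.valuation : ℕ) : ZMod (p ^ n)) * k * u.mul_inv
    have h₃ : Nat.card (Set.range (toZModPow n a * ·)) = p ^ (n - a.valuation) := by
      rw [h₁]
      refine (Nat.card_zmultiples _).trans ?_
      rw [ZMod.addOrderOf_coe _ (pow_ne_zero _ (NeZero.ne p)),
        Nat.gcd_eq_right (pow_dvd_pow _ hn), Nat.pow_div hn (NeZero.pos p)]
    rw [h₃, norm_eq_zpow_neg_valuation ha, Nat.card_zmod, Nat.cast_pow, Nat.cast_pow,
      pow_sub₀ _ hp hn]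
    field_simp
    simp

lemma tendsto_rangeDensity (N : Matrix (Fin 2) (Fin 2) ℤ_[p]) :
    Tendsto (fun n : ℕ => rangeDensity (N.map (toZModPow n))) atTop (𝓝 ‖N.det‖) := by
  obtain ⟨U, V, a, b, rfl⟩ := exists_smith N
  have h (n : ℕ) : rangeDensity ((U.val * diagonal ![a, a * b] * V.val).map (toZModPow n)) =
      rangeDensity (diagonal ![toZModPow n a, toZModPow n (a * b)]) := by
    rw [← rangeDensity_mul_mul (redGL (Fin 2) n U) (redGL (Fin 2) n V) (diagonal _),
      Matrix.map_mul, Matrix.map_mul, Matrix.diagonal_map (map_zero _)]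
    change rangeDensity (_ * diagonal _ * _) = rangeDensity (_ * diagonal _ * _)
    congr 4
    ext i
    fin_cases i <;> rfl
  simp only [h, rangeDensity_diagonal]
  rw [Matrix.det_mul, Matrix.det_mul, norm_mul, norm_mul, norm_det_GL, norm_det_GL, one_mul,
    mul_one, Matrix.det_diagonal, Fin.prod_univ_two, norm_mul]
  exact (tendsto_card_range_mul a).mul (tendsto_card_range_mul (a * b))

end PadicInt

end

noncomputable section

namespace Matrix

lemma rangeDensity_nonneg {R : Type*} [CommRing R] (N : Matrix (Fin 2) (Fin 2) R) :
    0 ≤ rangeDensity N := by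
  unfold rangeDensity
  positivity

lemma rangeDensity_le_one {R : Type*} [CommRing R] [Finite R] (N : Matrix (Fin 2) (Fin 2) R) :
    rangeDensity N ≤ 1 := by
  refine div_le_one_of_le₀ ?_ (by positivity)
  have h : Nat.card (Set.range N.mulVec) ≤ Nat.card (Fin 2 → R) := Finite.card_range_le _
  rw [Nat.card_fun] at h
  simpa using (Nat.cast_le (α := ℝ)).2 h

end Matrix

namespace PadicInt

variable {p : ℕ} [Fact p.Prime]

lemma isOpen_preimage_toZModPow (n : ℕ) (c : ZMod (p ^ n)) :
    IsOpen ((toZModPow n : ℤ_[p] →+* ZMod (p ^ n)) ⁻¹' {c}) := by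
  rw [Metric.isOpen_iff]
  intro x hx
  have hp : 0 < (p : ℝ) := by exact_mod_cast (Fact.out : p.Prime).pos
  refine ⟨(p : ℝ) ^ (-n : ℤ), by positivity, fun y hy => ?_⟩
  rw [Metric.mem_ball, dist_eq_norm] at hy
  have := (norm_le_pow_iff_mem_span_pow _ _).1 hy.le
  rw [← ker_toZModPow, RingHom.mem_ker, map_sub, sub_eq_zero] at this
  exact this.trans hx

lemma continuous_GL_apply (i j : Fin 2) : Continuous fun M : GL (Fin 2) ℤ_[p] => M.val i j :=
  Units.continuous_val.matrix_elem i j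

lemma isOpen_preimage_redGL (n : ℕ) (g : GL (Fin 2) (ZMod (p ^ n))) :
    IsOpen (redGL (p := p) (Fin 2) n ⁻¹' {g}) := by
  have : redGL (p := p) (Fin 2) n ⁻¹' {g} =
      ⋂ (i : Fin 2) (j : Fin 2), (fun M : GL (Fin 2) ℤ_[p] => M.val i j) ⁻¹'
        (toZModPow n ⁻¹' {g.val i j}) := by
    ext M
    simp only [Set.mem_preimage, Set.mem_singleton_iff, Set.mem_iInter, Units.ext_iff,
      ← Matrix.ext_iff]
    rfl
  rw [this]
  exact isOpen_iInter_of_finite fun i => isOpen_iInter_of_finite fun j =>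
    (isOpen_preimage_toZModPow n _).preimage (continuous_GL_apply i j)

variable [MeasurableSpace (GL (Fin 2) ℤ_[p])] [BorelSpace (GL (Fin 2) ℤ_[p])]

lemma measurableSet_preimage_rangeRestrict_redGL (n : ℕ) (g : (redGL (p := p) (Fin 2) n).range) :
    MeasurableSet ((redGL (p := p) (Fin 2) n).rangeRestrict ⁻¹' {g}) := by
  convert (isOpen_preimage_redGL n g.1).measurableSet using 1
  ext M
  simp [Subtype.ext_iff]

lemma measurable_rangeDensity_map (n : ℕ) : Measurable fun M : GL (Fin 2) ℤ_[p] =>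
    Matrix.rangeDensity ((M.val - 1).map (toZModPow n)) := by
  let _ : MeasurableSpace (redGL (p := p) (Fin 2) n).range := ⊤
  have hm : Measurable (redGL (p := p) (Fin 2) n).rangeRestrict :=
    measurable_to_countable' (measurableSet_preimage_rangeRestrict_redGL n)
  have hf : Measurable fun g : (redGL (p := p) (Fin 2) n).range =>
    Matrix.rangeDensity (g.1.val - 1) := Measurable.of_discrete
  convert hf.comp hm using 3 with M
  rw [Matrix.map_sub _ (map_sub _), Matrix.map_one _ (map_zero _) (map_one _)]
  rfl

end PadicInt

namespace EllipticArboreal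

open WeierstrassCurve.Affine PadicInt

lemma powNegOrd_eq_norm {ℓ : ℕ} [Fact ℓ.Prime] (x : ℤ_[ℓ]) : powNegOrd x = ‖x‖ := by
  rw [powNegOrd]
  split_ifs with h
  · rw [h, norm_zero]
  · rw [norm_eq_zpow_neg_valuation h]

lemma integrand_eq_norm {ℓ : ℕ} [Fact ℓ.Prime] (M : GL (Fin 2) ℤ_[ℓ]) :
    integrand M = ‖(M.val - 1).det‖ :=
  powNegOrd_eq_norm _

universe u v

variable {K : Type u} [Field K] {Ω : Type v} [Field Ω] [Algebra K Ω] [Normal K Ω]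
  {E : WeierstrassCurve K} {ℓ : ℕ} {α : (E⁄K).Point} [Fact ℓ.Prime]
  [MeasurableSpace (GL (Fin 2) ℤ_[ℓ])] [BorelSpace (GL (Fin 2) ℤ_[ℓ])]

lemma HasFullImage.fixedProportion_eq_integral (h : HasFullImage Ω E ℓ α)
    (μ : Measure (GL (Fin 2) ℤ_[ℓ])) [μ.IsMulLeftInvariant] [IsProbabilityMeasure μ] (n : ℕ) :
    fixedProportion Ω E ℓ α n =
      ∫ M, Matrix.rangeDensity ((M.val - 1).map (toZModPow n)) ∂μ := by
  have := Fintype.ofFinite (redGL (p := ℓ) (Fin 2) n).range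
  have hav := integral_comp_monoidHom_of_finite (μ := μ)
    (redGL (p := ℓ) (Fin 2) n).rangeRestrict_surjective
    (measurableSet_preimage_rangeRestrict_redGL n) fun g => Matrix.rangeDensity (g.1.val - 1)
  rw [h.fixedProportion_eq]
  convert hav.symm using 3 with M
  · congr!
  · rw [Matrix.map_sub _ (map_sub _), Matrix.map_one _ (map_zero _) (map_one _)]
    rfl

theorem HasFullImage.isFixedDensity (h : HasFullImage Ω E ℓ α)
    (μ : Measure (GL (Fin 2) ℤ_[ℓ])) [μ.IsMulLeftInvariant] [IsProbabilityMeasure μ] :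
    IsFixedDensity Ω E ℓ α (∫ M, integrand M ∂μ) := by
  rw [IsFixedDensity, funext (h.fixedProportion_eq_integral μ)]
  refine tendsto_integral_of_dominated_convergence (fun _ => 1)
    (fun n => (measurable_rangeDensity_map n).aestronglyMeasurable) (integrable_const _)
    (fun n => ae_of_all _ fun M => ?_) (ae_of_all _ fun M => ?_)
  · rw [Real.norm_of_nonneg (Matrix.rangeDensity_nonneg _)]
    exact Matrix.rangeDensity_le_one _
  · rw [integrand_eq_norm]
    exact tendsto_rangeDensity _

end EllipticArboreal

end

noncomputable section

/-- Averaging the translates of a function does not change its integral. -/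
lemma integral_integral_add_eq {X Y : Type*} [AddCommGroup X] [MeasurableSpace X]
    [MeasurableAdd₂ X] {ν : Measure X} [ν.IsAddLeftInvariant] [IsProbabilityMeasure ν]
    [MeasurableSpace Y] {ξ : Measure Y} [IsProbabilityMeasure ξ] {ψ : Y → X} (hψ : Measurable ψ)
    {f : X → ℝ} (hf : Measurable f) {C : ℝ} (hC : ∀ x, ‖f x‖ ≤ C) :
    ∫ x, ∫ y, f (x + ψ y) ∂ξ ∂ν = ∫ x, f x ∂ν := by
  have hm : Measurable (Function.uncurry fun x y => f (x + ψ y)) :=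
    hf.comp (measurable_fst.add (hψ.comp measurable_snd))
  rw [integral_integral_swap (Integrable.of_bound hm.aestronglyMeasurable C
    (ae_of_all _ fun z => hC _))]
  simp only [integral_add_right_eq_self, integral_const, probReal_univ, one_smul]

lemma integral_comp_addMonoidHom_of_surjective {X : Type*} [AddCommGroup X] [TopologicalSpace X]
    [IsTopologicalAddGroup X] [CompactSpace X] [MeasurableSpace X] [BorelSpace X]
    (ν : Measure X) [ν.IsAddHaarMeasure] {φ : X →+ X} (hc : Continuous φ)
    (hs : Function.Surjective φ) {f : X → ℝ} (hf : Measurable f) :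
    ∫ x, f (φ x) ∂ν = ∫ x, f x ∂ν := by
  have h : MeasurePreserving φ ν ν := AddMonoidHom.measurePreserving hc hs rfl
  conv_rhs => rw [← h.map_eq]
  rw [integral_map hc.aemeasurable hf.aestronglyMeasurable]

namespace PadicInt

lemma card_matrix_zmod (p : ℕ) : (Nat.card (Matrix (Fin 2) (Fin 2) (ZMod p)) : ℝ) = (p : ℝ) ^ 4 := by
  have h : Nat.card (Fin 2 → Fin 2 → ZMod p) = p ^ 4 := by
    simp only [Nat.card_fun, Nat.card_zmod, Nat.card_fin]
    ring
  exact_mod_cast h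

variable {p : ℕ} [Fact p.Prime]

lemma norm_eq_one_iff_toZMod_ne_zero {x : ℤ_[p]} : ‖x‖ = 1 ↔ toZMod x ≠ 0 := by
  rw [← isUnit_iff, Ne, ← RingHom.mem_ker, ker_toZMod, IsLocalRing.mem_maximalIdeal, mem_nonunits_iff,
    not_not]

lemma toZMod_eq_zero_iff_dvd {x : ℤ_[p]} : toZMod x = 0 ↔ (p : ℤ_[p]) ∣ x := by
  rw [← RingHom.mem_ker, ker_toZMod, maximalIdeal_eq_span_p, Ideal.mem_span_singleton]

lemma toZMod_p_mul (x : ℤ_[p]) : toZMod ((p : ℤ_[p]) * x) = 0 :=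
  toZMod_eq_zero_iff_dvd.2 (dvd_mul_right _ _)

lemma isOpen_preimage_toZMod (c : ZMod p) : IsOpen ((toZMod : ℤ_[p] →+* ZMod p) ⁻¹' {c}) := by
  rw [Metric.isOpen_iff]
  intro x hx
  refine ⟨1, one_pos, fun y hy => ?_⟩
  rw [Metric.mem_ball, dist_eq_norm, norm_lt_one_iff_dvd, ← toZMod_eq_zero_iff_dvd, map_sub,
    sub_eq_zero] at hy
  exact hy.trans hx

section Norm

variable [MeasurableSpace ℤ_[p]] [BorelSpace ℤ_[p]] (τ : Measure ℤ_[p])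
  [τ.IsAddLeftInvariant]

lemma measurableSet_preimage_toZMod (c : ZMod p) :
    MeasurableSet ((toZMod : ℤ_[p] →+* ZMod p) ⁻¹' {c}) :=
  (isOpen_preimage_toZMod c).measurableSet

lemma integral_norm [IsProbabilityMeasure τ] : ∫ t : ℤ_[p], ‖t‖ ∂τ = p / (p + 1) := by
  have hp : (p : ℝ) ≠ 0 := by simp [NeZero.ne p]
  have hp0 : 0 < (p : ℝ) := by positivity
  have h₁ := integral_integral_add_eq (ν := τ) (ξ := τ) (ψ := fun y : ℤ_[p] => p * y)
    (measurable_const_mul _) (f := fun t : ℤ_[p] => ‖t‖) measurable_norm (C := 1)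
    (fun x => by simpa using norm_le_one x)
  have h₂ (r : ℤ_[p]) : ∫ y : ℤ_[p], ‖r + p * y‖ ∂τ =
      if toZMod r = 0 then (p : ℝ)⁻¹ * ∫ t : ℤ_[p], ‖t‖ ∂τ else 1 := by
    split_ifs with hr
    · obtain ⟨s, rfl⟩ := toZMod_eq_zero_iff_dvd.1 hr
      simp only [← mul_add, norm_mul, norm_p, integral_const_mul]
      rw [integral_add_left_eq_self fun y : ℤ_[p] => ‖y‖]
    · have h (y : ℤ_[p]) : ‖r + p * y‖ = 1 := by
        rwa [norm_eq_one_iff_toZMod_ne_zero, map_add, toZMod_p_mul, add_zero]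
      simp [h]
  have h₃ := integral_comp_addMonoidHom_of_finite (μ := τ)
    (φ := (toZMod : ℤ_[p] →+* ZMod p).toAddMonoidHom) (ZMod.ringHom_surjective _)
    measurableSet_preimage_toZMod
    (fun c => if c = 0 then (p : ℝ)⁻¹ * ∫ t : ℤ_[p], ‖t‖ ∂τ else 1)
  simp only [h₂] at h₁
  have h₄ : ∫ t : ℤ_[p], ‖t‖ ∂τ = _ := h₁.symm.trans h₃
  rw [← Finset.add_sum_erase _ _ (Finset.mem_univ (0 : ZMod p)), if_pos rfl,
    Finset.sum_congr rfl (g := fun _ => (1 : ℝ))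
      fun c hc => if_neg (Finset.ne_of_mem_erase hc)] at h₄
  simp only [Finset.sum_const, Finset.card_erase_of_mem (Finset.mem_univ _), Finset.card_univ,
    ZMod.card, Nat.card_zmod, nsmul_eq_mul, mul_one,
    Nat.cast_sub (Fact.out : p.Prime).one_lt.le, Nat.cast_one] at h₄
  have hp2 : ((p : ℝ) - 1) ≠ 0 := by
    have : (1 : ℝ) < p := by exact_mod_cast (Fact.out : p.Prime).one_lt
    linarith
  rw [eq_div_iff (by positivity)]
  field_simp at h₄
  refine mul_left_cancel₀ hp2 ?_
  linear_combination h₄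

lemma integral_norm_mul_add {u : ℤ_[p]} (hu : ‖u‖ = 1) (w : ℤ_[p]) :
    ∫ t : ℤ_[p], ‖u * t + w‖ ∂τ = ∫ t : ℤ_[p], ‖t‖ ∂τ := by
  obtain ⟨v, rfl⟩ := isUnit_iff.2 hu
  rw [← integral_add_right_eq_self (fun t : ℤ_[p] => ‖t‖) (v⁻¹.val * w)]
  congr 1
  ext t
  rw [← one_mul ‖t + _‖, ← hu, ← norm_mul, mul_add, Units.mul_inv_cancel_left]

end Norm

section Det

open Matrix

instance : CompactSpace (Matrix (Fin 2) (Fin 2) ℤ_[p]) :=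
  inferInstanceAs (CompactSpace (Fin 2 → Fin 2 → ℤ_[p]))

instance : SecondCountableTopology (Matrix (Fin 2) (Fin 2) ℤ_[p]) :=
  inferInstanceAs (SecondCountableTopology (Fin 2 → Fin 2 → ℤ_[p]))

/-- Reduction modulo `p` of matrices of `p`-adic integers. -/
def redMat : Matrix (Fin 2) (Fin 2) ℤ_[p] →+* Matrix (Fin 2) (Fin 2) (ZMod p) :=
  (toZMod : ℤ_[p] →+* ZMod p).mapMatrix

lemma redMat_apply (N : Matrix (Fin 2) (Fin 2) ℤ_[p]) (i j : Fin 2) :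
    redMat N i j = toZMod (N i j) := rfl

lemma det_redMat (N : Matrix (Fin 2) (Fin 2) ℤ_[p]) : (redMat N).det = toZMod N.det :=
  (RingHom.map_det _ _).symm

lemma redMat_surjective : Function.Surjective (redMat (p := p)) := fun N => by
  choose M hM using fun i j => ZMod.ringHom_surjective (toZMod : ℤ_[p] →+* ZMod p) (N i j)
  exact ⟨Matrix.of M, Matrix.ext hM⟩

lemma redMat_eq_zero_iff {N : Matrix (Fin 2) (Fin 2) ℤ_[p]} :
    redMat N = 0 ↔ ∃ M, N = (p : ℤ_[p]) • M := by
  constructor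
  · intro h
    choose M hM using fun i j => toZMod_eq_zero_iff_dvd.1 (congrFun (congrFun h i) j)
    exact ⟨Matrix.of M, Matrix.ext hM⟩
  · rintro ⟨M, rfl⟩
    ext i j
    exact toZMod_p_mul _

lemma redMat_add_smul (N M : Matrix (Fin 2) (Fin 2) ℤ_[p]) :
    redMat (N + (p : ℤ_[p]) • M) = redMat N := by
  rw [map_add, redMat_eq_zero_iff.2 ⟨M, rfl⟩, add_zero]

lemma isOpen_preimage_redMat (N : Matrix (Fin 2) (Fin 2) (ZMod p)) :
    IsOpen (redMat (p := p) ⁻¹' {N}) := by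
  have : redMat (p := p) ⁻¹' {N} = ⋂ (i : Fin 2) (j : Fin 2),
      (fun M : Matrix (Fin 2) (Fin 2) ℤ_[p] => M i j) ⁻¹' (toZMod ⁻¹' {N i j}) := by
    ext M
    simp only [Set.mem_preimage, Set.mem_singleton_iff, Set.mem_iInter, ← Matrix.ext_iff,
      redMat_apply]
  rw [this]
  exact isOpen_iInter_of_finite fun i => isOpen_iInter_of_finite fun j =>
    (isOpen_preimage_toZMod _).preimage (continuous_id.matrix_elem i j)

lemma norm_det_smul (M : Matrix (Fin 2) (Fin 2) ℤ_[p]) :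
    ‖((p : ℤ_[p]) • M).det‖ = ((p : ℝ) ^ 2)⁻¹ * ‖M.det‖ := by
  rw [det_smul, Fintype.card_fin, norm_mul, norm_pow, norm_p, inv_pow]

lemma norm_det_diagonal_add_smul (a b t : ℤ_[p]) (x : Matrix (Fin 2) (Fin 2) ℤ_[p]) :
    ‖(diagonal ![a, a * (p * b)] + (p : ℤ_[p]) • (x + !![0, 0; 0, t])).det‖ =
      (p : ℝ)⁻¹ * ‖(a + p * x 0 0) * t +
        ((a + p * x 0 0) * (a * b + x 1 1) - p * x 0 1 * x 1 0)‖ := by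
  rw [← norm_p, ← norm_mul]
  congr 1
  rw [det_fin_two]
  simp
  ring

lemma continuous_single_one_one :
    Continuous fun t : ℤ_[p] => (!![0, 0; 0, t] : Matrix (Fin 2) (Fin 2) ℤ_[p]) := by
  refine continuous_matrix fun i j => ?_
  fin_cases i <;> fin_cases j <;> simp <;> fun_prop

variable [MeasurableSpace (Matrix (Fin 2) (Fin 2) ℤ_[p])]
  [BorelSpace (Matrix (Fin 2) (Fin 2) ℤ_[p])] (ν : Measure (Matrix (Fin 2) (Fin 2) ℤ_[p]))

lemma measurable_comp_redMat (f : Matrix (Fin 2) (Fin 2) (ZMod p) → ℝ) :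
    Measurable fun N => f (redMat (p := p) N) := by
  let _ : MeasurableSpace (Matrix (Fin 2) (Fin 2) (ZMod p)) := ⊤
  have hm : Measurable (redMat (p := p)) :=
    measurable_to_countable' fun N => (isOpen_preimage_redMat N).measurableSet
  exact (Measurable.of_discrete (f := f)).comp hm

lemma measurable_norm_det : Measurable fun N : Matrix (Fin 2) (Fin 2) ℤ_[p] => ‖N.det‖ :=
  (continuous_id.matrix_det.norm).measurable

lemma integral_comp_redMat [ν.IsAddHaarMeasure]
    [IsProbabilityMeasure ν] (f : Matrix (Fin 2) (Fin 2) (ZMod p) → ℝ) :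
    ∫ N, f (redMat N) ∂ν = (∑ N, f N) / (p : ℝ) ^ 4 := by
  refine (integral_comp_addMonoidHom_of_finite (μ := ν) (φ := (redMat (p := p)).toAddMonoidHom)
    redMat_surjective (fun N => (isOpen_preimage_redMat N).measurableSet) f).trans ?_
  congr 1
  exact card_matrix_zmod p

lemma integral_comp_mul_mul [ν.IsAddHaarMeasure] (U V : GL (Fin 2) ℤ_[p])
    {f : Matrix (Fin 2) (Fin 2) ℤ_[p] → ℝ}
    (hf : Measurable f) : ∫ N, f (U.val * N * V.val) ∂ν = ∫ N, f N ∂ν := by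
  refine integral_comp_addMonoidHom_of_surjective ν
    (φ := (AddMonoidHom.mulRight V.val).comp (AddMonoidHom.mulLeft U.val))
    ((continuous_const.mul continuous_id).mul continuous_const) (fun N => ?_) hf
  refine ⟨U⁻¹.val * N * V⁻¹.val, ?_⟩
  simp [mul_assoc]

lemma integral_norm_det_add_smul_of_det_ne_zero [IsProbabilityMeasure ν]
    {r : Matrix (Fin 2) (Fin 2) ℤ_[p]}
    (hr : (redMat r).det ≠ 0) : ∫ x, ‖(r + (p : ℤ_[p]) • x).det‖ ∂ν = 1 := by
  have h (x : Matrix (Fin 2) (Fin 2) ℤ_[p]) : ‖(r + (p : ℤ_[p]) • x).det‖ = 1 := by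
    rwa [norm_eq_one_iff_toZMod_ne_zero, ← det_redMat, redMat_add_smul]
  simp [h]

lemma integral_norm_det_add_smul_of_eq_zero [ν.IsAddHaarMeasure] {r : Matrix (Fin 2) (Fin 2) ℤ_[p]}
    (hr : redMat r = 0) : ∫ x, ‖(r + (p : ℤ_[p]) • x).det‖ ∂ν =
      ((p : ℝ) ^ 2)⁻¹ * ∫ x : Matrix (Fin 2) (Fin 2) ℤ_[p], ‖x.det‖ ∂ν := by
  obtain ⟨s, rfl⟩ := redMat_eq_zero_iff.1 hr
  simp only [← smul_add, norm_det_smul, integral_const_mul]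
  rw [integral_add_left_eq_self fun x : Matrix (Fin 2) (Fin 2) ℤ_[p] => ‖x.det‖]

lemma measurable_norm_det_add_smul (r : Matrix (Fin 2) (Fin 2) ℤ_[p]) :
    Measurable fun x : Matrix (Fin 2) (Fin 2) ℤ_[p] => ‖(r + (p : ℤ_[p]) • x).det‖ := by
  have h : Continuous fun x : Matrix (Fin 2) (Fin 2) ℤ_[p] => r + (p : ℤ_[p]) • x :=
    (continuous_const_smul _).const_add r
  exact h.matrix_det.norm.measurable

lemma integral_norm_det_diagonal_add_smul [ν.IsAddHaarMeasure]
    [IsProbabilityMeasure ν] {a : ℤ_[p]} (ha : toZMod a ≠ 0) (b : ℤ_[p]) :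
    ∫ x, ‖(diagonal ![a, a * (p * b)] + (p : ℤ_[p]) • x).det‖ ∂ν = 1 / (p + 1) := by
  have hp : (p : ℝ) ≠ 0 := by simp [NeZero.ne p]
  let _ : MeasurableSpace ℤ_[p] := borel _
  have _ : BorelSpace ℤ_[p] := ⟨rfl⟩
  obtain ⟨τ, _, _⟩ : ∃ τ : Measure ℤ_[p], τ.IsAddHaarMeasure ∧ IsProbabilityMeasure τ :=
    ⟨Measure.addHaarMeasure ⊤, inferInstance, ⟨Measure.addHaarMeasure_self⟩⟩
  rw [← integral_integral_add_eq (ν := ν) (ξ := τ) continuous_single_one_one.measurable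
    (measurable_norm_det_add_smul _) (C := 1) (fun x => by rw [norm_norm]; exact norm_le_one _)]
  have hu (x : Matrix (Fin 2) (Fin 2) ℤ_[p]) : ‖a + p * x 0 0‖ = 1 := by
    rwa [norm_eq_one_iff_toZMod_ne_zero, map_add, toZMod_p_mul, add_zero]
  simp only [norm_det_diagonal_add_smul, integral_const_mul, integral_norm_mul_add τ (hu _), integral_norm, integral_const,
    probReal_univ, one_smul]
  field_simp

lemma integral_norm_det_mul_mul_add_smul [ν.IsAddHaarMeasure] (U V : GL (Fin 2) ℤ_[p])
    (r : Matrix (Fin 2) (Fin 2) ℤ_[p]) :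
    ∫ x, ‖(U.val * r * V.val + (p : ℤ_[p]) • x).det‖ ∂ν = ∫ x, ‖(r + (p : ℤ_[p]) • x).det‖ ∂ν := by
  rw [← integral_comp_mul_mul ν U⁻¹ V⁻¹ (measurable_norm_det_add_smul r)]
  congr 1
  ext x
  have : U.val * r * V.val + (p : ℤ_[p]) • x =
      U.val * (r + (p : ℤ_[p]) • (U⁻¹.val * x * V⁻¹.val)) * V.val := by
    simp [mul_add, add_mul, mul_assoc]
  rw [this, det_mul, det_mul, norm_mul, norm_mul, norm_det_GL, norm_det_GL, one_mul, mul_one]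

lemma integral_norm_det_add_smul_of_det_eq_zero [ν.IsAddHaarMeasure]
    [IsProbabilityMeasure ν] {r : Matrix (Fin 2) (Fin 2) ℤ_[p]}
    (hr : redMat r ≠ 0) (hd : (redMat r).det = 0) :
    ∫ x, ‖(r + (p : ℤ_[p]) • x).det‖ ∂ν = 1 / (p + 1) := by
  obtain ⟨U, V, a, b, rfl⟩ := exists_smith r
  have ha : toZMod a ≠ 0 := by
    intro ha
    obtain ⟨a', rfl⟩ := toZMod_eq_zero_iff_dvd.1 ha
    refine hr (redMat_eq_zero_iff.2 ⟨U.val * diagonal ![a', a' * b] * V.val, ?_⟩)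
    rw [← Matrix.smul_mul, ← Matrix.mul_smul, ← diagonal_smul]
    congr 3
    ext i
    fin_cases i <;> simp [mul_assoc]
  have hb : toZMod b = 0 := by
    rw [det_redMat, ← not_ne_iff, ← norm_eq_one_iff_toZMod_ne_zero, det_mul, det_mul, norm_mul,
      norm_mul, norm_det_GL, norm_det_GL, one_mul, mul_one, det_diagonal, Fin.prod_univ_two,
      norm_eq_one_iff_toZMod_ne_zero, not_ne_iff] at hd
    simpa [ha] using hd
  obtain ⟨b', rfl⟩ := toZMod_eq_zero_iff_dvd.1 hb
  rw [integral_norm_det_mul_mul_add_smul, integral_norm_det_diagonal_add_smul ν ha]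

/-- The integral over a residue class modulo `p` of the norm of the determinant, normalized by the
measure of this class. -/
def detWeight (p : ℕ) (D : ℝ) (N : Matrix (Fin 2) (Fin 2) (ZMod p)) : ℝ :=
  if N = 0 then ((p : ℝ) ^ 2)⁻¹ * D else if N.det = 0 then 1 / (p + 1) else 1

lemma integral_comp_redMat_mul_norm_det [ν.IsAddHaarMeasure]
    [IsProbabilityMeasure ν] (f : Matrix (Fin 2) (Fin 2) (ZMod p) → ℝ) :
    ∫ N, f (redMat N) * ‖N.det‖ ∂ν =
      (∑ N, f N * detWeight p (∫ x : Matrix (Fin 2) (Fin 2) ℤ_[p], ‖x.det‖ ∂ν) N) / (p : ℝ) ^ 4 := by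
  obtain ⟨C, hC⟩ : ∃ C, ∀ N, ‖f N‖ ≤ C := by
    obtain ⟨N, hN⟩ := Finite.exists_max fun N => ‖f N‖
    exact ⟨_, hN⟩
  rw [← integral_integral_add_eq (ν := ν) (ξ := ν) (f := fun N => f (redMat N) * ‖N.det‖)
    (ψ := fun x : Matrix (Fin 2) (Fin 2) ℤ_[p] => (p : ℤ_[p]) • x)
    (continuous_const_smul _).measurable
    ((measurable_comp_redMat f).mul measurable_norm_det) (C := C), ← integral_comp_redMat ν]
  · congr 1
    ext r
    simp only [redMat_add_smul, integral_const_mul]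
    congr 1
    unfold detWeight
    split_ifs with h₁ h₂
    · exact integral_norm_det_add_smul_of_eq_zero ν h₁
    · exact integral_norm_det_add_smul_of_det_eq_zero ν h₁ h₂
    · exact integral_norm_det_add_smul_of_det_ne_zero ν h₂
  · intro x
    rw [norm_mul, norm_norm]
    exact (mul_le_of_le_one_right (norm_nonneg _) (norm_le_one _)).trans (hC _)

end Det

end PadicInt

end

noncomputable section

namespace Matrix

/-- A two by two matrix as the quadruple of its entries. -/
def finTwoEquivProd (F : Type*) : F × F × F × F ≃ Matrix (Fin 2) (Fin 2) F where
  toFun x := !![x.1, x.2.1; x.2.2.1, x.2.2.2]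
  invFun N := (N 0 0, N 0 1, N 1 0, N 1 1)
  left_inv _ := rfl
  right_inv N := (eta_fin_two N).symm

section Count

variable (F : Type*) [Field F] [Fintype F] [DecidableEq F]

lemma sum_ite_det_ne_zero :
    ∑ N : Matrix (Fin 2) (Fin 2) F, (if N.det ≠ 0 then (1 : ℝ) else 0) =
      ((Fintype.card F : ℝ) ^ 2 - 1) * ((Fintype.card F : ℝ) ^ 2 - Fintype.card F) := by
  have h₁ : Set.range (Units.val : GL (Fin 2) F → Matrix (Fin 2) (Fin 2) F) =
      {N | N.det ≠ 0} := by
    ext N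
    rw [Set.mem_ofPred_eq, ← isUnit_iff_ne_zero, ← isUnit_iff_isUnit_det]
    rfl
  have h₂ := Nat.card_range_of_injective (Units.val_injective (α := Matrix (Fin 2) (Fin 2) F))
  rw [h₁, card_GL_field, Fin.prod_univ_two, Nat.card_eq_fintype_card] at h₂
  have h₃ : 1 ≤ Fintype.card F ^ 2 := Nat.one_le_pow _ _ Fintype.card_pos
  have h₄ : Fintype.card F ≤ Fintype.card F ^ 2 := Nat.le_self_pow two_ne_zero _
  rw [Finset.sum_boole, ← Fintype.card_subtype]
  refine (congrArg Nat.cast h₂).trans ?_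
  simp only [Fin.val_zero, pow_zero, Fin.val_one, pow_one]
  push_cast [h₃, h₄]
  rfl

lemma sum_ite_mul_eq (k : F) :
    ∑ b : F, ∑ c : F, (if b * c = k then (1 : ℝ) else 0) =
      (Fintype.card F - 1) + if k = 0 then (Fintype.card F : ℝ) else 0 := by
  have h : ∀ b ∈ Finset.univ.erase (0 : F), ∑ c : F, (if b * c = k then (1 : ℝ) else 0) = 1 := by
    intro b hb
    have hb := Finset.ne_of_mem_erase hb
    simp [← eq_inv_mul_iff_mul_eq₀ hb]
  rw [← Finset.add_sum_erase _ _ (Finset.mem_univ (0 : F)), Finset.sum_congr rfl h]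
  simp only [zero_mul, Finset.sum_const, Finset.card_erase_of_mem (Finset.mem_univ _),
    Finset.card_univ, nsmul_eq_mul, mul_one, Nat.cast_sub Fintype.card_pos, Nat.cast_one,
    @eq_comm _ 0 k, mul_ite, mul_zero]
  ring

lemma sum_ite_det_eq_zero_and_det_one_add_eq_zero :
    ∑ N : Matrix (Fin 2) (Fin 2) F, (if N.det = 0 ∧ (1 + N).det = 0 then (1 : ℝ) else 0) =
      (Fintype.card F : ℝ) ^ 2 + Fintype.card F := by
  have h (a b c d : F) : ((finTwoEquivProd F (a, b, c, d)).det = 0 ∧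
      (1 + finTwoEquivProd F (a, b, c, d)).det = 0) ↔ d = -1 - a ∧ b * c = a * (-1 - a) := by
    change !![a, b; c, d].det = 0 ∧ (1 + !![a, b; c, d]).det = 0 ↔ _
    simp only [det_fin_two, one_fin_two, add_apply, of_apply, cons_val', cons_val_zero,
      cons_val_one, cons_val_fin_one, zero_add]
    constructor
    · rintro ⟨h₁, h₂⟩
      have h₃ : d = -1 - a := by linear_combination h₂ - h₁
      subst h₃
      exact ⟨rfl, by linear_combination -h₁⟩
    · rintro ⟨rfl, h₂⟩
      exact ⟨by linear_combination -h₂, by linear_combination -h₂⟩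
  have h₀ (a : F) : a * (-1 - a) = 0 ↔ a = 0 ∨ a = -1 := by
    rw [mul_eq_zero, sub_eq_zero, @eq_comm _ (-1)]
  have h₁ (a : F) : (if a = 0 ∨ a = -1 then (Fintype.card F : ℝ) else 0) =
      (if a = 0 then (Fintype.card F : ℝ) else 0) +
        if a = -1 then (Fintype.card F : ℝ) else 0 := by
    by_cases h : a = 0
    · simp [h]
    · simp [h]
  rw [← (finTwoEquivProd F).sum_comp]
  simp only [Fintype.sum_prod_type, h, ite_and, Finset.sum_ite_eq', Finset.mem_univ, if_true,
    sum_ite_mul_eq, h₀, h₁, Finset.sum_add_distrib, Finset.sum_const, Finset.card_univ,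
    nsmul_eq_mul]
  ring

end Count

end Matrix

namespace PadicInt

open Matrix

variable {p : ℕ} [Fact p.Prime]

lemma detWeight_eq (D : ℝ) (N : Matrix (Fin 2) (Fin 2) (ZMod p)) :
    detWeight p D N = (if N.det ≠ 0 then 1 else 0) * (p / (p + 1)) + 1 / (p + 1) +
      (if N = 0 then ((p : ℝ) ^ 2)⁻¹ * D - 1 / (p + 1) else 0) := by
  have hp : (p : ℝ) + 1 ≠ 0 := by positivity
  unfold detWeight
  by_cases h₁ : N = 0
  · simp [h₁]
  · by_cases h₂ : N.det = 0
    · simp [h₁, h₂]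
    · simp [h₁, h₂]
      field_simp

lemma sum_detWeight (D : ℝ) : ∑ N, detWeight p D N =
    ((p : ℝ) ^ 2 - 1) * ((p : ℝ) ^ 2 - p) * (p / (p + 1)) + (p : ℝ) ^ 4 * (1 / (p + 1)) +
      (((p : ℝ) ^ 2)⁻¹ * D - 1 / (p + 1)) := by
  simp only [detWeight_eq, Finset.sum_add_distrib, ← Finset.sum_mul, sum_ite_det_ne_zero,
    Nat.card_zmod, Finset.sum_const, Finset.card_univ, nsmul_eq_mul, ← Nat.card_eq_fintype_card, card_matrix_zmod,
    Finset.sum_ite_eq', Finset.mem_univ, if_true]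

lemma sum_ite_det_one_add_ne_zero :
    ∑ N : Matrix (Fin 2) (Fin 2) (ZMod p), (if (1 + N).det ≠ 0 then (1 : ℝ) else 0) =
      ((p : ℝ) ^ 2 - 1) * ((p : ℝ) ^ 2 - p) := by
  have h := sum_ite_det_ne_zero (ZMod p)
  rw [ZMod.card] at h
  rw [← h]
  exact Equiv.sum_comp (Equiv.addLeft (1 : Matrix (Fin 2) (Fin 2) (ZMod p)))
    fun N : Matrix (Fin 2) (Fin 2) (ZMod p) => if N.det ≠ 0 then (1 : ℝ) else 0

lemma sum_ite_mul_detWeight (D : ℝ) :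
    ∑ N : Matrix (Fin 2) (Fin 2) (ZMod p), (if (1 + N).det ≠ 0 then 1 else 0) * detWeight p D N =
      ((p : ℝ) ^ 2 - 1) * ((p : ℝ) ^ 2 - p) - ((p : ℝ) ^ 4 - ((p : ℝ) ^ 2 - 1) * ((p : ℝ) ^ 2 - p) -
        (p : ℝ) ^ 2 - p) * (p / (p + 1)) + (((p : ℝ) ^ 2)⁻¹ * D - 1 / (p + 1)) := by
  have hp : (p : ℝ) + 1 ≠ 0 := by positivity
  have h (N : Matrix (Fin 2) (Fin 2) (ZMod p)) :
      (if (1 + N).det ≠ 0 then 1 else 0) * detWeight p D N =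
        (if (1 + N).det ≠ 0 then 1 else 0) - (1 - (if N.det ≠ 0 then 1 else 0) -
          (if N.det = 0 ∧ (1 + N).det = 0 then 1 else 0)) * (p / (p + 1)) +
        (if N = 0 then ((p : ℝ) ^ 2)⁻¹ * D - 1 / (p + 1) else 0) := by
    rw [detWeight_eq]
    by_cases h₁ : N = 0
    · simp [h₁]
      field_simp
      ring
    · by_cases h₂ : N.det = 0 <;> by_cases h₃ : (1 + N).det = 0 <;> simp [h₁, h₂, h₃] <;>
        field_simp <;> ring
  simp only [h, Finset.sum_add_distrib, Finset.sum_sub_distrib, ← Finset.sum_mul,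
    sum_ite_det_ne_zero, sum_ite_det_one_add_ne_zero, sum_ite_det_eq_zero_and_det_one_add_eq_zero,
    Nat.card_zmod, Finset.sum_const, Finset.card_univ, nsmul_eq_mul, ← Nat.card_eq_fintype_card, card_matrix_zmod, mul_one,
    Finset.sum_ite_eq', Finset.mem_univ, if_true]
  ring

section Measure

variable [MeasurableSpace (Matrix (Fin 2) (Fin 2) ℤ_[p])]
  [BorelSpace (Matrix (Fin 2) (Fin 2) ℤ_[p])] (ν : Measure (Matrix (Fin 2) (Fin 2) ℤ_[p]))
  [ν.IsAddHaarMeasure] [IsProbabilityMeasure ν]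

lemma integral_norm_det : ∫ x : Matrix (Fin 2) (Fin 2) ℤ_[p], ‖x.det‖ ∂ν =
    (p : ℝ) ^ 2 / ((p : ℝ) ^ 2 + p + 1) := by
  have hp : 1 < (p : ℝ) := by exact_mod_cast (Fact.out : p.Prime).one_lt
  have h := integral_comp_redMat_mul_norm_det ν fun _ => 1
  simp only [one_mul, sum_detWeight] at h
  generalize ∫ x : Matrix (Fin 2) (Fin 2) ℤ_[p], ‖x.det‖ ∂ν = D at h ⊢
  rw [eq_div_iff (by positivity)]
  field_simp at h
  have h₁ : ((p : ℝ) ^ 3 + 1) * ((p - 1) * (p + 1)) ≠ 0 := by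
    have : 0 < (p : ℝ) - 1 := by linarith
    positivity
  refine mul_left_cancel₀ h₁ ?_
  linear_combination h

lemma measurable_norm_det_sub_one :
    Measurable fun N : Matrix (Fin 2) (Fin 2) ℤ_[p] => ‖(N - 1).det‖ :=
  (continuous_id.sub continuous_const).matrix_det.norm.measurable

variable [MeasurableSpace (GL (Fin 2) ℤ_[p])] [BorelSpace (GL (Fin 2) ℤ_[p])]
  (μ : Measure (GL (Fin 2) ℤ_[p])) [μ.IsMulLeftInvariant] [IsProbabilityMeasure μ]

/-- Haar measure on `GL₂(ℤ_p)` is the normalized restriction of the additive Haar measure on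
matrices. -/
lemma integral_ite_mul_eq_integral_GL {h : Matrix (Fin 2) (Fin 2) ℤ_[p] → ℝ} (hm : Measurable h)
    {C : ℝ} (hC : ∀ x, ‖h x‖ ≤ C) :
    ∫ N, (if (redMat N).det ≠ 0 then 1 else 0) * h N ∂ν =
      (∫ N : Matrix (Fin 2) (Fin 2) ℤ_[p], (if (redMat N).det ≠ 0 then 1 else 0) ∂ν) *
        ∫ M : GL (Fin 2) ℤ_[p], h M.val ∂μ := by
  set f : Matrix (Fin 2) (Fin 2) ℤ_[p] → ℝ := fun N => (if (redMat N).det ≠ 0 then 1 else 0) * h N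
    with hf
  have hfm : Measurable f :=
    (measurable_comp_redMat fun N => if N.det ≠ 0 then (1 : ℝ) else 0).mul hm
  have hfC (N) : ‖f N‖ ≤ C := by
    have := (norm_nonneg _).trans (hC N)
    simp only [hf]
    split_ifs
    · simpa using hC N
    · simpa using this
  have h₁ (M : GL (Fin 2) ℤ_[p]) : ∫ N, f (N * M.val) ∂ν = ∫ N, f N ∂ν := by
    simpa using integral_comp_mul_mul ν 1 M hfm
  have hc : Continuous fun z : GL (Fin 2) ℤ_[p] × Matrix (Fin 2) (Fin 2) ℤ_[p] => z.2 * z.1.val :=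
    continuous_snd.mul (Units.continuous_val.comp continuous_fst)
  have h₂ : ∫ M, ∫ N, f (N * M.val) ∂ν ∂μ = ∫ N, ∫ M : GL (Fin 2) ℤ_[p], f (N * M.val) ∂μ ∂ν :=
    integral_integral_swap (Integrable.of_bound (hfm.comp hc.measurable).aestronglyMeasurable C
      (ae_of_all _ fun z => hfC _))
  simp only [h₁, integral_const, probReal_univ, one_smul] at h₂
  rw [h₂, ← integral_mul_const]
  congr 1
  ext N
  have h₃ (M : GL (Fin 2) ℤ_[p]) : (redMat (N * M.val)).det ≠ 0 ↔ (redMat N).det ≠ 0 := by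
    rw [det_redMat, det_redMat, ← norm_eq_one_iff_toZMod_ne_zero, ← norm_eq_one_iff_toZMod_ne_zero,
      det_mul, norm_mul, norm_det_GL, mul_one]
  simp only [hf, h₃, integral_const_mul]
  split_ifs with hN
  · rw [det_redMat, ← norm_eq_one_iff_toZMod_ne_zero, ← isUnit_iff, ← isUnit_iff_isUnit_det] at hN
    obtain ⟨U, rfl⟩ := hN
    congr 1
    exact integral_mul_left_eq_self (fun M : GL (Fin 2) ℤ_[p] => h M.val) U
  · simp

end Measure

theorem integral_norm_det_sub_one [MeasurableSpace (GL (Fin 2) ℤ_[p])]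
    [BorelSpace (GL (Fin 2) ℤ_[p])] (μ : Measure (GL (Fin 2) ℤ_[p])) [μ.IsMulLeftInvariant]
    [IsProbabilityMeasure μ] : ∫ M : GL (Fin 2) ℤ_[p], ‖(M.val - 1).det‖ ∂μ =
      ((p : ℝ) ^ 5 - (p : ℝ) ^ 4 - (p : ℝ) ^ 3 + (p : ℝ) + 1) /
        ((p : ℝ) ^ 5 - (p : ℝ) ^ 3 - (p : ℝ) ^ 2 + 1) := by
  let _ : MeasurableSpace (Matrix (Fin 2) (Fin 2) ℤ_[p]) := borel _
  have _ : BorelSpace (Matrix (Fin 2) (Fin 2) ℤ_[p]) := ⟨rfl⟩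
  obtain ⟨ν, _, _⟩ : ∃ ν : Measure (Matrix (Fin 2) (Fin 2) ℤ_[p]),
      ν.IsAddHaarMeasure ∧ IsProbabilityMeasure ν :=
    ⟨Measure.addHaarMeasure ⊤, inferInstance, ⟨Measure.addHaarMeasure_self⟩⟩
  have hp : 1 < (p : ℝ) := by exact_mod_cast (Fact.out : p.Prime).one_lt
  have h₁ := integral_ite_mul_eq_integral_GL ν μ measurable_norm_det_sub_one (C := 1)
    fun N => by rw [norm_norm]; exact norm_le_one _
  have h₂ := integral_comp_redMat ν fun N => if N.det ≠ 0 then (1 : ℝ) else 0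
  have h₃ := integral_comp_redMat_mul_norm_det ν fun N => if (1 + N).det ≠ 0 then (1 : ℝ) else 0
  rw [← integral_add_left_eq_self _ (1 : Matrix (Fin 2) (Fin 2) ℤ_[p])] at h₁
  simp only [map_add, map_one, add_sub_cancel_left] at h₁
  rw [h₂, h₃, sum_ite_mul_detWeight, sum_ite_det_ne_zero, integral_norm_det, ZMod.card] at h₁
  generalize ∫ M : GL (Fin 2) ℤ_[p], ‖(M.val - 1).det‖ ∂μ = I at h₁ ⊢
  have h₄ : (p : ℝ) ^ 5 - (p : ℝ) ^ 3 - (p : ℝ) ^ 2 + 1 =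
      (p - 1) ^ 2 * (p + 1) * (p ^ 2 + p + 1) := by ring
  have h₅ : 0 < (p : ℝ) - 1 := by linarith
  rw [h₄, eq_div_iff (by positivity)]
  field_simp at h₁
  refine mul_left_cancel₀ (a := (p : ℝ) * (p + 1)) (by positivity) ?_
  linear_combination -h₁

end PadicInt

namespace EllipticArboreal

lemma integrable_integrand {ℓ : ℕ} [Fact ℓ.Prime] [MeasurableSpace (GL (Fin 2) ℤ_[ℓ])]
    [BorelSpace (GL (Fin 2) ℤ_[ℓ])] (μ : Measure (GL (Fin 2) ℤ_[ℓ])) [IsFiniteMeasure μ] :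
    Integrable (fun M => integrand M) μ := by
  have h : Continuous fun M : GL (Fin 2) ℤ_[ℓ] => ‖(M.val - 1).det‖ :=
    (Units.continuous_val.sub continuous_const).matrix_det.norm
  simp only [integrand_eq_norm]
  exact Integrable.of_bound h.measurable.aestronglyMeasurable 1
    (ae_of_all _ fun M => by rw [norm_norm]; exact PadicInt.norm_le_one _)

end EllipticArboreal

end

theorem theorem12 (ℓ : ℕ) [Fact ℓ.Prime]
    [MeasurableSpace (GL (Fin 2) ℤ_[ℓ])] [BorelSpace (GL (Fin 2) ℤ_[ℓ])]
    (μ : Measure (GL (Fin 2) ℤ_[ℓ])) [μ.IsHaarMeasure] [IsProbabilityMeasure μ] :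
    (∀ (K : Type*) [Field K] (Ω : Type*) [Field Ω] [Algebra K Ω] [IsSepClosure K Ω]
        (E : WeierstrassCurve K) [E.IsElliptic] (α : (E⁄K).Point),
        EllipticArboreal.HasFullImage Ω E ℓ α →
          EllipticArboreal.IsFixedDensity Ω E ℓ α (∫ M, EllipticArboreal.integrand M ∂μ) ∧
          EllipticArboreal.IsFixedDensity Ω E ℓ α
            (((ℓ : ℝ) ^ 5 - (ℓ : ℝ) ^ 4 - (ℓ : ℝ) ^ 3 + (ℓ : ℝ) + 1) /
              ((ℓ : ℝ) ^ 5 - (ℓ : ℝ) ^ 3 - (ℓ : ℝ) ^ 2 + 1)) ∧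
          (ℓ = 2 → EllipticArboreal.IsFixedDensity Ω E ℓ α (11 / 21))) ∧
    Integrable (fun M => EllipticArboreal.integrand M) μ ∧
    ∫ M, EllipticArboreal.integrand M ∂μ =
      ((ℓ : ℝ) ^ 5 - (ℓ : ℝ) ^ 4 - (ℓ : ℝ) ^ 3 + (ℓ : ℝ) + 1) /
        ((ℓ : ℝ) ^ 5 - (ℓ : ℝ) ^ 3 - (ℓ : ℝ) ^ 2 + 1) := by
  have hI : ∫ M, EllipticArboreal.integrand M ∂μ =
      ((ℓ : ℝ) ^ 5 - (ℓ : ℝ) ^ 4 - (ℓ : ℝ) ^ 3 + (ℓ : ℝ) + 1) /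
        ((ℓ : ℝ) ^ 5 - (ℓ : ℝ) ^ 3 - (ℓ : ℝ) ^ 2 + 1) := by
    simp only [EllipticArboreal.integrand_eq_norm]
    exact PadicInt.integral_norm_det_sub_one μ
  refine ⟨fun K _ Ω _ _ _ E _ α h => ?_, EllipticArboreal.integrable_integrand μ, hI⟩
  have _ : IsGalois K Ω := IsSepClosure.isGalois
  have hd := h.isFixedDensity μ
  refine ⟨hd, hI ▸ hd, ?_⟩
  rintro rfl
  rw [hI] at hd
  convert hd using 1
  norm_num
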